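/- Let $M$ be a compact smooth manifold of dimension $m$, possibly with boundary, and let $n\in\mathbb N$. Let $\Omega^1(M,\mathbb R^n)$ be the space of smooth $\mathbb R^n$-valued one-forms on $M$ and $\Gamma(S^2T^*M)$ the space of smooth symmetric $(0,2)$-tensor fields, both with their Fréchet ($C^\infty$) topology. Let $\Omega^1_+(M,\mathbb R^n)\subset\Omega^1(M,\mathbb R^n)$ be the subset of full-ranked one-forms, i.e. those $\alpha$ for which $\alpha_x:T_xM\to\mathbb R^n$ is injective for every $x\in M$, and let $\operatorname{Met}(M)\subset\Gamma(S^2T^*M)$ be the subset of smooth Riemannian metrics. These are open subsets, so their tangent spaces at every point are $\Omega^1(M,\mathbb R^n)$ and $\Gamma(S^2T^*M)$. For $g\in\operatorname{Met}(M)$ let $\mu_g$ be its Riemannian volume, $\mu_g=\sqrt{\det(g_{ij})}\,dx$ in local coordinates. For a one-form $\alpha$ let $\alpha^T\alpha$ be the pull-back of the Euclidean scalar product, $(\alpha^T\alpha)_x(v,w)=\langle\alpha_x v,\alpha_x w\rangle_{\mathbb R^n}$. Equip $\Omega^1_+(M,\mathbb R^n)$ with the generalized Ebin metric $$G_\alpha(\zeta,\eta)=\int_M\operatorname{tr}\big(\zeta_x\,(\alpha^T\alpha)_x^{-1}\,\eta_x^T\big)\,\mu_{\alpha^T\alpha},\qquad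 \alpha\in\Omega^1_+(M,\mathbb R^n),\ \zeta,\eta\in\Omega^1(M,\mathbb R^n),$$ and $\operatorname{Met}(M)$ with one quarter of the Ebin metric, $$(h,k)_g=\frac14\int_M\operatorname{tr}\big(h\,g^{-1}k\,g^{-1}\big)\,\mu_g,\qquad g\in\operatorname{Met}(M),\ h,k\in\Gamma(S^2T^*M),$$ where at each $x$ the tensors are replaced by their matrices with respect to a basis of $T_xM$ (and the standard basis of $\mathbb R^n$); the integrands do not depend on the basis. These are inner products on the tangent spaces (weak Riemannian metrics). **Theorem.** If $\Omega^1_+(M,\mathbb R^n)\neq\emptyset$, then $$\tilde\pi:\Omega^1_+(M,\mathbb R^n)\to\operatorname{Met}(M),\qquad \alpha\mapsto\alpha^T\alpha,$$ is surjective and is a Riemannian submersion with respect to these metrics. That is: $\tilde\pi$ is a smooth map between open subsets of Fréchet spaces; for every $\alpha\in\Omega^1_+(M,\mathbb R^n)$ the differential $d\tilde\pi_\alpha:\Omega^1(M,\mathbb R^n)\to\Gamma(S^2T^*M)$ is a continuous linear map with a continuous linear right inverse; $\Omega^1(M,\mathbb R^n)$ is the direct sum of $\ker d\tilde\pi_\alpha$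 and the horizontal space $\mathcal H_\alpha$, the $G_\alpha$-orthogonal complement of $\ker d\tilde\pi_\alpha$; and $d\tilde\pi_\alpha$ restricts to an isometric isomorphism from $(\mathcal H_\alpha,G_\alpha)$ onto $(\Gamma(S^2T^*M),(\cdot,\cdot)_{\tilde\pi(\alpha)})$. -/

import Mathlib

open Set Filter Topology MeasureTheory Bundle Matrix
open scoped Manifold ContDiff UniformConvergence

noncomputable section

/-! ### Differential calculus on open subsets of Fréchet spaces -/

/-- `v ↦ L v` is the directional derivative (Gateaux derivative) of `f` at `x`. -/
def HasGateauxDerivAt {X Y : Type*} [AddCommGroup X] [Module ℝ X]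
    [AddCommGroup Y] [Module ℝ Y] [TopologicalSpace Y]
    (f : X → Y) (L : X → Y) (x : X) : Prop :=
  ∀ v : X, Tendsto (fun t : ℝ => t⁻¹ • (f (x + t • v) - f x)) (𝓝[≠] 0) (𝓝 (L v))

/-- `f` is of class `C^k` on the open set `U` in the sense of Michal, Bastiani and Hamilton:
`f` is continuous on `U` and, for `k ≥ 1`, all directional derivatives `df(x)v` exist for
`x ∈ U` and the map `(x, v) ↦ df(x)v` is of class `C^(k-1)` on `U × X`. -/
def IsFrechetC {Y : Type*} [AddCommGroup Y] [Module ℝ Y] [TopologicalSpace Y] :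
    ℕ → ∀ (X : Type*) [AddCommGroup X] [Module ℝ X] [TopologicalSpace X],
      (X → Y) → Set X → Prop
  | 0, _, _, _, _, f, U => ContinuousOn f U
  | k + 1, X, _, _, _, f, U => ContinuousOn f U ∧ ∃ df : X × X → Y,
      (∀ x ∈ U, HasGateauxDerivAt f (fun v => df (x, v)) x) ∧
      IsFrechetC k (X × X) df (U ×ˢ (univ : Set X))

/-- `f` is smooth on the open set `U` of a Fréchet space. -/
def IsFrechetSmooth {X Y : Type*} [AddCommGroup X] [Module ℝ X] [TopologicalSpace X]
    [AddCommGroup Y] [Module ℝ Y] [TopologicalSpace Y] (f : X → Y) (U : Set X) : Prop :=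
  ∀ k : ℕ, IsFrechetC k X f U

/-- `G` is a (real) inner product on the vector space `X`: bilinear, symmetric, positive
definite.  It need not induce the topology of `X`. -/
def IsInnerProduct {X : Type*} [AddCommGroup X] [Module ℝ X] (G : X → X → ℝ) : Prop :=
  (∃ B : LinearMap.BilinForm ℝ X, ∀ v w, B v w = G v w) ∧
  (∀ v w, G v w = G w v) ∧
  ∀ v, v ≠ 0 → 0 < G v v

/-- The vectors that are `G`-orthogonal to the kernel of `D`. -/
def horizontalSpace {X Y : Type*} [AddCommGroup X] [Zero Y]
    (G : X → X → ℝ) (D : X → Y) : Set X :=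
  {v | ∀ w, D w = 0 → G v w = 0}

/-- Let `U` and `V` be subsets of topological vector spaces `X` and `Y`, let `G a` (`a ∈ U`) be
inner products on `X = T_a U`, and `H b` (`b ∈ V`) inner products on `Y = T_b V`.  The map `f`
is a Riemannian submersion from `(U, G)` onto `(V, H)` if `U` and `V` are open and `f : U → V` is
a smooth surjective map whose differential at every `a ∈ U` is a surjective continuous linear map
with split kernel (that is, with a continuous linear right inverse), and
restricts to an isometric isomorphism from the horizontal space
(the `G a`-orthogonal complement of the kernel) onto `(Y, H (f a))`. -/
structure IsRiemannianSubmersion {X Y : Type*}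
    [AddCommGroup X] [Module ℝ X] [TopologicalSpace X]
    [AddCommGroup Y] [Module ℝ Y] [TopologicalSpace Y]
    (U : Set X) (V : Set Y) (G : X → X → X → ℝ) (H : Y → Y → Y → ℝ) (f : X → Y) : Prop where
  isOpen_source : IsOpen U
  isOpen_target : IsOpen V
  inner_source : ∀ a ∈ U, IsInnerProduct (G a)
  inner_target : ∀ b ∈ V, IsInnerProduct (H b)
  mapsTo : MapsTo f U V
  surjOn : SurjOn f U V
  smooth : IsFrechetSmooth f U
  differential : ∀ a ∈ U, ∃ D : X →L[ℝ] Y, HasGateauxDerivAt f D a ∧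
    (∃ R : Y →L[ℝ] X, ∀ k, D (R k) = k) ∧
    BijOn D (horizontalSpace (G a) D) univ ∧
    (∀ v ∈ horizontalSpace (G a) D, ∀ w ∈ horizontalSpace (G a) D,
      H (f a) (D v) (D w) = G a v w) ∧
    (∀ u : X, ∃ v ∈ horizontalSpace (G a) D, ∃ w, D w = 0 ∧ u = v + w)

/-! ### The Fréchet topology on smooth sections of a vector bundle -/

section SectionTopology

variable {E : Type*} [NormedAddCommGroup E] [NormedSpace ℝ E]
  {H : Type*} [TopologicalSpace H] {I : ModelWithCorners ℝ E H}
  {M : Type*} [TopologicalSpace M] [ChartedSpace H M]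
  {F : Type*} [NormedAddCommGroup F] [NormedSpace ℝ F]
  {V : M → Type*} [TopologicalSpace (TotalSpace F V)] [∀ x, TopologicalSpace (V x)]
  [FiberBundle F V]

/-- The section `s` read in the chart and in the trivialization of the bundle at `x₀`. -/
def sectionLocalRep (s : Cₛ^∞⟮I; F, V⟯) (x₀ : M) (y : E) : F :=
  (trivializationAt F V x₀ ⟨(extChartAt I x₀).symm y, s ((extChartAt I x₀).symm y)⟩).2

/-- The compact subsets of the part of the chart domain at `x₀` (read in the model space) over
which the trivialization at `x₀` is defined. -/
def localCompacts (I : ModelWithCorners ℝ E H) (F : Type*) [NormedAddCommGroup F]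
    [NormedSpace ℝ F] (V : M → Type*)
    [TopologicalSpace (TotalSpace F V)] [∀ x, TopologicalSpace (V x)]
    [FiberBundle F V] (x₀ : M) : Set (Set E) :=
  {K | IsCompact K ∧
    K ⊆ (extChartAt I x₀).target ∩ (extChartAt I x₀).symm ⁻¹' (trivializationAt F V x₀).baseSet}

/-- The `C^∞` topology on smooth sections: uniform convergence of all derivatives
of the local representatives on compact subsets of the chart domains. -/
instance smoothSectionTopology : TopologicalSpace (Cₛ^∞⟮I; F, V⟯) :=
  ⨅ (x₀ : M) (k : ℕ), TopologicalSpace.induced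
    (fun s => UniformOnFun.ofFun (localCompacts I F V x₀)
      (iteratedFDerivWithin ℝ k (sectionLocalRep s x₀) (extChartAt I x₀).target))
    inferInstance

end SectionTopology

/-! ### One-forms, symmetric tensors and metrics -/

section Objects

variable {m : ℕ} {n : ℕ} {H : Type*} [TopologicalSpace H]

/-- `Ω¹(M, ℝⁿ)`: smooth `ℝⁿ`-valued one-forms on `M`. -/
abbrev OneForm (I : ModelWithCorners ℝ (EuclideanSpace ℝ (Fin m)) H)
    (M : Type*) [TopologicalSpace M] [ChartedSpace H M] [IsManifold I ∞ M] (n : ℕ) : Type _ :=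
  Cₛ^∞⟮I; EuclideanSpace ℝ (Fin m) →L[ℝ] EuclideanSpace ℝ (Fin n),
    fun x : M => TangentSpace I x →L[ℝ] EuclideanSpace ℝ (Fin n)⟯

/-- Smooth `(0,2)`-tensor fields on `M`. -/
abbrev Tensor02 (I : ModelWithCorners ℝ (EuclideanSpace ℝ (Fin m)) H)
    (M : Type*) [TopologicalSpace M] [ChartedSpace H M] [IsManifold I ∞ M] : Type _ :=
  Cₛ^∞⟮I; EuclideanSpace ℝ (Fin m) →L[ℝ] EuclideanSpace ℝ (Fin m) →L[ℝ] ℝ,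
    fun x : M => TangentSpace I x →L[ℝ] TangentSpace I x →L[ℝ] ℝ⟯

variable {I : ModelWithCorners ℝ (EuclideanSpace ℝ (Fin m)) H}
    {M : Type*} [TopologicalSpace M] [ChartedSpace H M] [IsManifold I ∞ M]

/- Shortcut instances, to speed up instance search. -/
instance tangentDualContinuousAdd (x : M) : ContinuousAdd (TangentSpace I x →L[ℝ] ℝ) :=
  IsTopologicalAddGroup.toContinuousAdd

instance tensor02AddCommGroup : AddCommGroup (Tensor02 I M) := inferInstance

instance tensor02Module : Module ℝ (Tensor02 I M) := inferInstance

variable (I M) in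
/-- `Γ(S²T*M)`: smooth symmetric `(0,2)`-tensor fields on `M`. -/
def SymTensor : Submodule ℝ (Tensor02 I M) where
  carrier := {h | ∀ (x : M) (v w : TangentSpace I x), h x v w = h x w v}
  add_mem' := by
    intro a b ha hb x v w
    have h1 := ha x v w
    have h2 := hb x v w
    change a x v w + b x v w = a x w v + b x w v
    rw [h1, h2]
  zero_mem' := fun _ _ _ => rfl
  smul_mem' := by
    intro c a ha x v w
    change c * a x v w = c * a x w v
    rw [ha x v w]

variable (I M) in
/-- `Ω¹₊(M, ℝⁿ)`: the one-forms `α` such that `α x` is injective for every `x`. -/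
def fullRankForms (n : ℕ) : Set (OneForm I M n) :=
  {α | ∀ x : M, Function.Injective (α x)}

variable (I M) in
/-- `Met(M)`: the smooth Riemannian metrics on `M`. -/
def riemannianMetrics : Set (SymTensor I M) :=
  {g | ∀ (x : M) (v : TangentSpace I x), v ≠ 0 → 0 < g.1 x v v}

/-- The pull-back `aᵀa` of the Euclidean scalar product under a linear map `a : ℝᵐ → ℝⁿ`. -/
def gramForm (a : EuclideanSpace ℝ (Fin m) →L[ℝ] EuclideanSpace ℝ (Fin n)) :
    EuclideanSpace ℝ (Fin m) →L[ℝ] EuclideanSpace ℝ (Fin m) →L[ℝ] ℝ :=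
  (innerSL ℝ).bilinearComp a a

theorem gramForm_apply (a : EuclideanSpace ℝ (Fin m) →L[ℝ] EuclideanSpace ℝ (Fin n))
    (v w : EuclideanSpace ℝ (Fin m)) : gramForm a v w = inner ℝ (a v) (a w) := rfl

/-- `(αᵀα)_x`: the pull-back of the Euclidean scalar product under `α x`. -/
def pullbackInner (α : OneForm I M n) (x : M) :
    TangentSpace I x →L[ℝ] TangentSpace I x →L[ℝ] ℝ :=
  gramForm (α x : EuclideanSpace ℝ (Fin m) →L[ℝ] EuclideanSpace ℝ (Fin n))

theorem pullbackInner_apply (α : OneForm I M n) (x : M) (v w : TangentSpace I x) :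
    pullbackInner α x v w = inner ℝ (α x v) (α x w) := rfl

theorem contDiff_gramForm : ContDiff ℝ ∞ (gramForm (m := m) (n := n)) := by
  have h : (gramForm (m := m) (n := n)) = fun a =>
      ((ContinuousLinearMap.compL ℝ (EuclideanSpace ℝ (Fin m))
        (EuclideanSpace ℝ (Fin n)) ℝ).flip a).comp ((innerSL ℝ).comp a) := by
    funext a
    ext v w
    rfl
  rw [h]
  fun_prop

theorem contMDiff_pullbackInner (α : OneForm I M n) :
    ContMDiff I (I.prod 𝓘(ℝ, EuclideanSpace ℝ (Fin m) →L[ℝ] EuclideanSpace ℝ (Fin m) →L[ℝ] ℝ)) ∞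
      (fun x => TotalSpace.mk'
        (EuclideanSpace ℝ (Fin m) →L[ℝ] EuclideanSpace ℝ (Fin m) →L[ℝ] ℝ)
        (E := fun x : M => TangentSpace I x →L[ℝ] TangentSpace I x →L[ℝ] ℝ)
        x (pullbackInner α x)) := by
  intro x₀
  have h := α.contMDiff x₀
  rw [contMDiffAt_section] at h ⊢
  have h2 := contDiff_gramForm.contMDiff.contMDiffAt.comp x₀ h
  refine h2.congr_of_eventuallyEq ?_
  have hb : (trivializationAt (EuclideanSpace ℝ (Fin m)) (TangentSpace I) x₀).baseSet ∈ 𝓝 x₀ :=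
    (trivializationAt _ _ x₀).open_baseSet.mem_nhds (FiberBundle.mem_baseSet_trivializationAt' x₀)
  filter_upwards [hb] with x hx
  ext v w
  rw [hom_trivializationAt_apply]
  simp only [Function.comp]
  rw [hom_trivializationAt_apply]
  rw [inCoordinates_apply_eq₂ hx hx (by simp)]
  simp [ContinuousLinearMap.inCoordinates, pullbackInner_apply, gramForm_apply,
    Trivialization.symmL_apply _ hx]

/-- The symmetric tensor field `αᵀα`. -/
def pullbackMetric (α : OneForm I M n) : SymTensor I M :=
  ⟨⟨pullbackInner α, contMDiff_pullbackInner α⟩, fun x v w => by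
    change pullbackInner α x v w = pullbackInner α x w v
    rw [pullbackInner_apply, pullbackInner_apply, real_inner_comm]⟩

/-! ### Integration with respect to the Riemannian volume -/

/-- The `j`-th standard basis vector of `T_x M`, which Mathlib identifies with `ℝᵐ`. -/
def stdVec (I : ModelWithCorners ℝ (EuclideanSpace ℝ (Fin m)) H) {M : Type*} [TopologicalSpace M]
    [ChartedSpace H M] [IsManifold I ∞ M] (x : M) (j : Fin m) : TangentSpace I x :=
  (EuclideanSpace.single j (1 : ℝ) : EuclideanSpace ℝ (Fin m))

/-- The coordinate vector field `∂/∂x^j` of the chart at `x₀`, at the point `x` of its domain. -/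
def coordVec (I : ModelWithCorners ℝ (EuclideanSpace ℝ (Fin m)) H) {M : Type*} [TopologicalSpace M]
    [ChartedSpace H M] [IsManifold I ∞ M] (x₀ x : M) (j : Fin m) : TangentSpace I x :=
  (trivializationAt (EuclideanSpace ℝ (Fin m)) (TangentSpace I) x₀).symmL ℝ x
    (EuclideanSpace.single j (1 : ℝ))

/-- The density `√det(g_ij)` of the Riemannian volume of `g` in the coordinates at `x₀`. -/
def volumeDensity (g : SymTensor I M) (x₀ x : M) : ℝ :=
  √(Matrix.of fun i j : Fin m => (g.1 x (coordVec I x₀ x i) (coordVec I x₀ x j) : ℝ)).det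

variable (I M) in
/-- A smooth partition of unity on `M`, indexed by `M`, such that the closed support of the
function with index `x₀` lies in the domain of the chart at `x₀`. -/
def chartPartition [T2Space M] [CompactSpace M] : SmoothPartitionOfUnity M I M univ :=
  (SmoothPartitionOfUnity.exists_isSubordinate_chartAt_source I M).choose

/-- `∫_M f μ_g`, the integral of `f` with respect to the Riemannian volume of `g`:
the function is cut up by a partition of unity and each piece is integrated in
coordinates against `√det(g_ij) dx`.  Since `M` is compact and the partition is locally finite,
only finitely many summands are nonzero. -/
def riemannianIntegral [T2Space M] [CompactSpace M] (g : SymTensor I M) (f : M → ℝ) : ℝ :=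
  ∑ᶠ x₀ : M, ∫ y in (extChartAt I x₀).target,
    chartPartition I M x₀ ((extChartAt I x₀).symm y) * f ((extChartAt I x₀).symm y) *
      volumeDensity g x₀ ((extChartAt I x₀).symm y)

/-! ### The two weak Riemannian metrics -/

/-- The `n × m` matrix of `α x` with respect to the standard bases of `T_x M` and `ℝⁿ`. -/
def formMatrix (α : OneForm I M n) (x : M) : Matrix (Fin n) (Fin m) ℝ :=
  Matrix.of fun i j => (α x (stdVec I x j) : EuclideanSpace ℝ (Fin n)) i

/-- The `m × m` matrix of `h x` with respect to the standard basis of `T_x M`. -/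
def tensorMatrix (h : SymTensor I M) (x : M) : Matrix (Fin m) (Fin m) ℝ :=
  Matrix.of fun i j => (h.1 x (stdVec I x i) (stdVec I x j) : ℝ)

/-- The generalized Ebin metric on `Ω¹₊(M, ℝⁿ)`:
`G_α(ζ, η) = ∫_M tr(ζ (αᵀα)⁻¹ ηᵀ) vol(αᵀα)`. -/
def generalizedEbin [T2Space M] [CompactSpace M] (α ζ η : OneForm I M n) : ℝ :=
  riemannianIntegral (pullbackMetric α) fun x =>
    (formMatrix ζ x * ((formMatrix α x)ᵀ * formMatrix α x)⁻¹ * (formMatrix η x)ᵀ).trace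

/-- The Ebin metric on `Met(M)`: `∫_M tr(h g⁻¹ k g⁻¹) μ_g`. -/
def ebin [T2Space M] [CompactSpace M] (g h k : SymTensor I M) : ℝ :=
  riemannianIntegral g fun x =>
    (tensorMatrix h x * (tensorMatrix g x)⁻¹ * tensorMatrix k x * (tensorMatrix g x)⁻¹).trace

end Objects

end

/-! Everything is pointwise linear algebra, carried over to sections by naturality under change of
frame. For an injective `a`, let `b = (aᵀa)⁻¹aᵀ` (`pinv a`). It satisfies `b a = 1`, and `a b` is
the orthogonal projection onto the range of `a`. The map `α ↦ αᵀα` is quadratic with differential `ζ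
↦ αᵀζ + ζᵀα`, and `k ↦ ½ bᵀk` is a right inverse of that differential on symmetric forms
(`symBil_liftBil`).

Since `(aᵀa)⁻¹ = b bᵀ`, the integrand of `G` is the Hilbert–Schmidt product of `ζ b` and `η b`
(`trace_eq_ebinIntegrand`), so `G` is visibly symmetric, positive definite and independent of the
frame. The lift is pointwise orthogonal to the kernel, because the pairing is the trace of a
symmetric times an antisymmetric matrix (`ebinIntegrand_liftBil_vertical`). It is isometric, the
factor ¼ being the square of the ½ in the lift (`quarter_trace_eq`). Hence `u = lift (D u) + (u -
lift (D u))` is the orthogonal splitting, and by definiteness the horizontal space is exactly the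
image of the lift (`horizontalLift_pullbackDeriv`). An explicit splitting of this kind needs no
completeness, although the metrics are weak.

For surjectivity, fix one full-ranked `β`. Given a metric `g`, the operator `Q = bᵀ g b + 1 - β b`
on `ℝⁿ` is symmetric positive definite with `⟨Q β v, β w⟩ = g(v, w)`, so `√Q β` is full-ranked and
induces `g`. It is smooth because `Q` does not depend on the frame (`transitionOp_comp`) and the
square root is smooth by the inverse function theorem (`contDiffWithinAt_posSqrt`).

On the analytic side, continuity in the `C^∞` topology follows from the Leibniz estimate
(`SmoothTendsto.bilin`), and continuous quadratic maps are smooth in the Fréchet sense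
(`isFrechetC_quadratic`). Openness uses only uniform closeness on finitely many compact chart
pieces. -/

noncomputable section

set_option maxSynthPendingDepth 3

local notation "𝔼" m:max => EuclideanSpace ℝ (Fin m)

/-! ### Quadratic maps between topological vector spaces -/

section Quadratic

variable {Y : Type*} [AddCommGroup Y] [Module ℝ Y]

/-- The polar form of the differential of the quadratic map `x ↦ B x x`. -/
def polarBilin {X : Type*} [AddCommGroup X] [Module ℝ X] (B : X →ₗ[ℝ] X →ₗ[ℝ] Y) :
    X × X →ₗ[ℝ] X × X →ₗ[ℝ] Y :=
  B.compl₁₂ (LinearMap.fst ℝ X X) (LinearMap.snd ℝ X X) +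
    B.flip.compl₁₂ (LinearMap.fst ℝ X X) (LinearMap.snd ℝ X X)

theorem polarBilin_apply {X : Type*} [AddCommGroup X] [Module ℝ X] (B : X →ₗ[ℝ] X →ₗ[ℝ] Y)
    (p q : X × X) : polarBilin B p q = B p.1 q.2 + B q.2 p.1 := rfl

variable [TopologicalSpace Y] [ContinuousAdd Y] [ContinuousSMul ℝ Y]

/-- For `t ≠ 0` the difference quotient is exactly `B x v + B v x + t • B v v`. -/
theorem hasGateauxDerivAt_quadratic {X : Type*} [AddCommGroup X] [Module ℝ X]
    (B : X →ₗ[ℝ] X →ₗ[ℝ] Y) (x : X) :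
    HasGateauxDerivAt (fun x => B x x) (fun v => B x v + B v x) x := by
  intro v
  have h : Tendsto (fun t : ℝ => B x v + B v x + t • B v v) (𝓝[≠] 0)
      (𝓝 (B x v + B v x + (0 : ℝ) • B v v)) :=
    tendsto_const_nhds.add ((tendsto_id.mono_left nhdsWithin_le_nhds).smul tendsto_const_nhds)
  rw [zero_smul, add_zero] at h
  refine h.congr' ?_
  filter_upwards [self_mem_nhdsWithin] with t ht
  have ht : t ≠ 0 := ht
  rw [eq_inv_smul_iff₀ ht]
  simp only [map_add, LinearMap.add_apply, map_smul, LinearMap.smul_apply]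
  module

/-- The differential `(x, v) ↦ B x v + B v x` is again quadratic, now on `X × X`, with bilinear form
`polarBilin B`. The induction therefore has to range over all spaces `X`. -/
theorem isFrechetC_quadratic (k : ℕ) : ∀ (X : Type*) [AddCommGroup X] [Module ℝ X]
    [TopologicalSpace X] (B : X →ₗ[ℝ] X →ₗ[ℝ] Y), Continuous (fun p : X × X => B p.1 p.2) →
    ∀ U : Set X, IsFrechetC k X (fun x => B x x) U := by
  induction k with
  | zero =>
    intro X _ _ _ B hB U
    exact (hB.comp (continuous_id.prodMk continuous_id)).continuousOn
  | succ k ih =>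
    intro X _ _ _ B hB U
    refine ⟨(hB.comp (continuous_id.prodMk continuous_id)).continuousOn,
      fun p => polarBilin B p p, fun x _ => hasGateauxDerivAt_quadratic B x,
      ih (X × X) (polarBilin B) ?_ _⟩
    simp only [polarBilin_apply]
    exact (hB.comp (by fun_prop : Continuous fun p : (X × X) × (X × X) => (p.1.1, p.2.2))).add
      (hB.comp (by fun_prop : Continuous fun p : (X × X) × (X × X) => (p.2.2, p.1.1)))

theorem isFrechetSmooth_quadratic {X : Type*} [AddCommGroup X] [Module ℝ X]
    [TopologicalSpace X] (B : X →ₗ[ℝ] X →ₗ[ℝ] Y) (hB : Continuous (fun p : X × X => B p.1 p.2))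
    (U : Set X) : IsFrechetSmooth (fun x => B x x) U :=
  fun k => isFrechetC_quadratic k X B hB U

end Quadratic

/-! ### Locally uniform convergence of all derivatives -/

section SmoothTendsto

variable {ι : Type*} {E : Type*} [NormedAddCommGroup E] [NormedSpace ℝ E]
  {A : Type*} [NormedAddCommGroup A] [NormedSpace ℝ A]
  {A' : Type*} [NormedAddCommGroup A'] [NormedSpace ℝ A']
  {C : Type*} [NormedAddCommGroup C] [NormedSpace ℝ C]

/-- All derivatives of `F i` converge to those of `f`, uniformly on compact subsets of `T`. -/
def SmoothTendsto (T : Set E) (l : Filter ι) (F : ι → E → A) (f : E → A) : Prop :=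
  ∀ k : ℕ, ∀ K ⊆ T, IsCompact K → TendstoUniformlyOn
    (fun i => iteratedFDerivWithin ℝ k (F i) T) (iteratedFDerivWithin ℝ k f T) l K

variable {T : Set E} {l : Filter ι} {F F' : ι → E → A} {f f' : E → A}

theorem SmoothTendsto.congr (h : SmoothTendsto T l F f) (hF : ∀ i, EqOn (F' i) (F i) T)
    (hf : EqOn f' f T) : SmoothTendsto T l F' f' := by
  intro k K hK hKc
  refine ((h k K hK hKc).congr (Eventually.of_forall fun i x hx => ?_)).congr_right
    fun x hx => ?_
  · exact (iteratedFDerivWithin_congr (hF i) (hK hx) k).symm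
  · exact (iteratedFDerivWithin_congr hf (hK hx) k).symm

theorem SmoothTendsto.refl (f : E → A) : SmoothTendsto T l (fun _ => f) f := by
  intro k K _ _ u hu
  exact Eventually.of_forall fun _ _ _ => refl_mem_uniformity hu

theorem SmoothTendsto.tendstoUniformlyOn (h : SmoothTendsto T l F f) {K : Set E} (hK : K ⊆ T)
    (hKc : IsCompact K) : TendstoUniformlyOn F f l K := by
  have := h 0 K hK hKc
  rw [Metric.tendstoUniformlyOn_iff] at this ⊢
  intro ε hε
  filter_upwards [this ε hε] with i hi x hx
  have := hi x hx
  rwa [iteratedFDerivWithin_zero_eq_comp, iteratedFDerivWithin_zero_eq_comp, Function.comp_apply,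
    Function.comp_apply, LinearIsometryEquiv.dist_map] at this

/-- Passing to the difference `F i - f` makes product-rule estimates applicable. -/
theorem smoothTendsto_iff (hT : UniqueDiffOn ℝ T) (hF : ∀ i, ContDiffOn ℝ ∞ (F i) T)
    (hf : ContDiffOn ℝ ∞ f T) : SmoothTendsto T l F f ↔
    ∀ k : ℕ, ∀ K ⊆ T, IsCompact K → ∀ ε > 0, ∀ᶠ i in l, ∀ x ∈ K,
      ‖iteratedFDerivWithin ℝ k (F i - f) T x‖ < ε := by
  refine forall_congr' fun k => forall_congr' fun K => forall_congr' fun hK =>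
    forall_congr' fun _ => ?_
  rw [Metric.tendstoUniformlyOn_iff]
  refine forall_congr' fun ε => forall_congr' fun _ => eventually_congr
    (Eventually.of_forall fun i => forall_congr' fun x => forall_congr' fun hx => ?_)
  rw [dist_comm, dist_eq_norm, iteratedFDerivWithin_sub_apply ((hF i).contDiffWithinAt (hK hx)
    |>.of_le (by exact_mod_cast le_top)) ((hf.contDiffWithinAt (hK hx)).of_le
      (by exact_mod_cast le_top)) hT (hK hx)]

theorem SmoothTendsto.add (hT : UniqueDiffOn ℝ T) (hF : ∀ i, ContDiffOn ℝ ∞ (F i) T)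
    (hf : ContDiffOn ℝ ∞ f T) (hF' : ∀ i, ContDiffOn ℝ ∞ (F' i) T)
    (hf' : ContDiffOn ℝ ∞ f' T) (h : SmoothTendsto T l F f) (h' : SmoothTendsto T l F' f') :
    SmoothTendsto T l (fun i x => F i x + F' i x) (fun x => f x + f' x) := by
  intro k K hK hKc
  refine (((h k K hK hKc).add (h' k K hK hKc)).congr
    (Eventually.of_forall fun i x hx => ?_)).congr_right fun x hx => ?_
  all_goals
    symm
    exact fun_iteratedFDerivWithin_add_apply
      (by first | exact ((hF i).contDiffWithinAt (hK hx)).of_le (by exact_mod_cast le_top)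
                | exact (hf.contDiffWithinAt (hK hx)).of_le (by exact_mod_cast le_top))
      (by first | exact ((hF' i).contDiffWithinAt (hK hx)).of_le (by exact_mod_cast le_top)
                | exact (hf'.contDiffWithinAt (hK hx)).of_le (by exact_mod_cast le_top))
      hT (hK hx)

theorem SmoothTendsto.const {c : ι → A} {a : A} (hT : UniqueDiffOn ℝ T) (h : Tendsto c l (𝓝 a)) :
    SmoothTendsto T l (fun i _ => c i) (fun _ : E => a) := by
  rw [smoothTendsto_iff hT (fun i => contDiffOn_const) contDiffOn_const]
  intro k K hK _ ε hε
  have h0 : Tendsto (fun i => ‖c i - a‖) l (𝓝 0) := tendsto_iff_norm_sub_tendsto_zero.mp h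
  filter_upwards [h0.eventually (gt_mem_nhds hε)] with i hi x hx
  have e : ((fun _ => c i) - fun _ => a : E → A) = fun _ => c i - a := rfl
  rw [e]
  rcases k with _ | k
  · simpa using hi
  · rw [iteratedFDerivWithin_succ_const]
    simpa using hε

/-- A bilinear expression is small in all derivatives if one factor is. -/
theorem eventually_norm_iteratedFDerivWithin_bilin_lt (B : A →L[ℝ] A' →L[ℝ] C)
    {u : ι → E → A} {v : ι → E → A'}
    (hT : UniqueDiffOn ℝ T) (hu : ∀ i, ContDiffOn ℝ ∞ (u i) T) (hv : ∀ i, ContDiffOn ℝ ∞ (v i) T)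
    {K : Set E} (hK : K ⊆ T) (k : ℕ)
    (hub : ∀ j, ∃ R : ℝ, ∀ᶠ i in l, ∀ x ∈ K, ‖iteratedFDerivWithin ℝ j (u i) T x‖ ≤ R)
    (hv0 : ∀ j, ∀ ε > 0, ∀ᶠ i in l, ∀ x ∈ K, ‖iteratedFDerivWithin ℝ j (v i) T x‖ < ε)
    {ε : ℝ} (hε : 0 < ε) :
    ∀ᶠ i in l, ∀ x ∈ K, ‖iteratedFDerivWithin ℝ k (fun y => B (u i y) (v i y)) T x‖ < ε := by
  choose R hR using hub
  -- `S` is the Leibniz constant. The bounds enter as `|R j|` because `R j` may be negative when `K`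
  -- is empty, and dividing by `S + 1` covers `S = 0` and gives the strict inequality.
  set S : ℝ := ‖B‖ * ∑ j ∈ Finset.range (k + 1), (k.choose j : ℝ) * |R j| with hS
  have hS0 : 0 ≤ S := by positivity
  have hδ : 0 < ε / (S + 1) := by positivity
  have h1 : ∀ᶠ i in l, ∀ j ∈ Finset.range (k + 1), ∀ x ∈ K,
      ‖iteratedFDerivWithin ℝ j (u i) T x‖ ≤ R j :=
    (Finset.eventually_all _).2 fun j _ => hR j
  have h2 : ∀ᶠ i in l, ∀ j ∈ Finset.range (k + 1), ∀ x ∈ K,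
      ‖iteratedFDerivWithin ℝ (k - j) (v i) T x‖ < ε / (S + 1) :=
    (Finset.eventually_all _).2 fun j _ => hv0 _ _ hδ
  filter_upwards [h1, h2] with i h1 h2 x hx
  refine (B.norm_iteratedFDerivWithin_le_of_bilinear (hu i) (hv i) hT (hK hx)
    (n := k) (by exact_mod_cast le_top)).trans_lt ?_
  calc ‖B‖ * ∑ j ∈ Finset.range (k + 1), (k.choose j : ℝ) *
        ‖iteratedFDerivWithin ℝ j (u i) T x‖ * ‖iteratedFDerivWithin ℝ (k - j) (v i) T x‖
      ≤ ‖B‖ * ∑ j ∈ Finset.range (k + 1), (k.choose j : ℝ) * |R j| * (ε / (S + 1)) := by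
        gcongr with j hj
        · exact (h1 j hj x hx).trans (le_abs_self _)
        · exact (h2 j hj x hx).le
    _ = S * (ε / (S + 1)) := by rw [← Finset.sum_mul, hS]; ring
    _ < ε := by
        rw [mul_div_assoc', div_lt_iff₀ (by positivity)]
        nlinarith

theorem exists_bound_iteratedFDerivWithin (hT : UniqueDiffOn ℝ T) (hf : ContDiffOn ℝ ∞ f T)
    {K : Set E} (hK : K ⊆ T) (hKc : IsCompact K) (j : ℕ) :
    ∃ R : ℝ, ∀ x ∈ K, ‖iteratedFDerivWithin ℝ j f T x‖ ≤ R :=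
  hKc.exists_bound_of_continuousOn
    ((hf.continuousOn_iteratedFDerivWithin (by exact_mod_cast le_top) hT).mono hK)

/-- Expand `B(F, G) - B(f, g) = B(f, G - g) + B(F - f, g) + B(F - f, G - g)`. Each term has a small
factor; the other is bounded on `K` by compactness or, in the last term, eventually bounded by 1. -/
theorem SmoothTendsto.bilin (B : A →L[ℝ] A' →L[ℝ] C) {G : ι → E → A'} {g : E → A'}
    (hT : UniqueDiffOn ℝ T) (hF : ∀ i, ContDiffOn ℝ ∞ (F i) T)
    (hf : ContDiffOn ℝ ∞ f T) (hG : ∀ i, ContDiffOn ℝ ∞ (G i) T)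
    (hg : ContDiffOn ℝ ∞ g T) (h : SmoothTendsto T l F f) (h' : SmoothTendsto T l G g) :
    SmoothTendsto T l (fun i x => B (F i x) (G i x)) (fun x => B (f x) (g x)) := by
  have hBs : ∀ {u : E → A} {v : E → A'}, ContDiffOn ℝ ∞ u T → ContDiffOn ℝ ∞ v T →
      ContDiffOn ℝ ∞ (fun x => B (u x) (v x)) T := fun hu hv =>
    (B.isBoundedBilinearMap.contDiff).comp_contDiffOn (hu.prodMk hv)
  have hBs' : ∀ {u : E → A} {v : E → A'}, ContDiffOn ℝ ∞ u T → ContDiffOn ℝ ∞ v T →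
      ContDiffOn ℝ ∞ (fun x => B.flip (v x) (u x)) T := fun hu hv => hBs hu hv
  rw [smoothTendsto_iff hT (fun i => hBs (hF i) (hG i)) (hBs hf hg)]
  rw [smoothTendsto_iff hT hF hf] at h
  rw [smoothTendsto_iff hT hG hg] at h'
  intro k K hK hKc ε hε
  have e1 := eventually_norm_iteratedFDerivWithin_bilin_lt (l := l) B hT (fun _ => hf)
    (fun i => (hG i).sub hg) hK k
    (fun j => (exists_bound_iteratedFDerivWithin hT hf hK hKc j).imp
      fun R hR => Eventually.of_forall fun i => hR)
    (fun j ε hε => h' j K hK hKc ε hε) (by positivity : 0 < ε / 3)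
  have e2 := eventually_norm_iteratedFDerivWithin_bilin_lt (l := l) B.flip hT (fun _ => hg)
    (fun i => (hF i).sub hf) hK k
    (fun j => (exists_bound_iteratedFDerivWithin hT hg hK hKc j).imp
      fun R hR => Eventually.of_forall fun i => hR)
    (fun j ε hε => h j K hK hKc ε hε) (by positivity : 0 < ε / 3)
  have e3 := eventually_norm_iteratedFDerivWithin_bilin_lt (l := l) B hT
    (fun i => (hF i).sub hf) (fun i => (hG i).sub hg) hK k
    (fun j => ⟨1, (h j K hK hKc 1 one_pos).mono fun i hi x hx => (hi x hx).le⟩)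
    (fun j ε hε => h' j K hK hKc ε hε) (by positivity : 0 < ε / 3)
  filter_upwards [e1, e2, e3] with i e1 e2 e3 x hx
  have s1 := hBs hf ((hG i).sub hg)
  have s2 := hBs' ((hF i).sub hf) hg
  have s3 := hBs ((hF i).sub hf) ((hG i).sub hg)
  have e : ((fun x => B (F i x) (G i x)) - fun x => B (f x) (g x)) =
      ((fun y => B (f y) (G i y - g y)) + fun y => B.flip (g y) (F i y - f y)) +
        fun y => B (F i y - f y) (G i y - g y) := by
    funext y
    simp only [Pi.sub_apply, Pi.add_apply, map_sub, _root_.sub_apply,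
      ContinuousLinearMap.flip_apply]
    abel
  have w : ∀ {u : E → C}, ContDiffOn ℝ ∞ u T → ContDiffWithinAt ℝ k u T x := fun hu =>
    (hu.contDiffWithinAt (hK hx)).of_le (by exact_mod_cast le_top)
  rw [e, iteratedFDerivWithin_add_apply (w (u := (fun y => B (f y) (G i y - g y)) +
    fun y => B.flip (g y) (F i y - f y)) (s1.add s2)) (w s3) hT (hK hx),
    iteratedFDerivWithin_add_apply (w s1) (w s2) hT (hK hx)]
  have := norm_add₃_le (a := iteratedFDerivWithin ℝ k (fun y => B (f y) (G i y - g y)) T x)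
    (b := iteratedFDerivWithin ℝ k (fun y => B.flip (g y) (F i y - f y)) T x)
    (c := iteratedFDerivWithin ℝ k (fun y => B (F i y - f y) (G i y - g y)) T x)
  linarith [e1 x hx, e2 x hx, e3 x hx]

end SmoothTendsto

/-! ### Linear algebra of injective linear maps and bilinear forms -/

section LinearAlgebra

variable {m n : ℕ}

/-- `⟨a v, b w⟩` as a bilinear form in `v` and `w`. -/
def innerBil : (𝔼 m →L[ℝ] 𝔼 n) →L[ℝ] (𝔼 m →L[ℝ] 𝔼 n) →L[ℝ] 𝔼 m →L[ℝ] 𝔼 m →L[ℝ] ℝ :=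
  ((ContinuousLinearMap.compL ℝ (𝔼 m) (𝔼 n →L[ℝ] ℝ) (𝔼 m →L[ℝ] ℝ)).comp
    (ContinuousLinearMap.compL ℝ (𝔼 m) (𝔼 n) ℝ).flip).flip.comp
      (ContinuousLinearMap.compL ℝ (𝔼 m) (𝔼 n) (𝔼 n →L[ℝ] ℝ) (innerSL ℝ))

/-- The bilinear form `aᵀb + bᵀa`. -/
def symBil : (𝔼 m →L[ℝ] 𝔼 n) →L[ℝ] (𝔼 m →L[ℝ] 𝔼 n) →L[ℝ] 𝔼 m →L[ℝ] 𝔼 m →L[ℝ] ℝ :=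
  innerBil + innerBil.flip

theorem symBil_apply (a b : 𝔼 m →L[ℝ] 𝔼 n) (v w : 𝔼 m) :
    symBil a b v w = inner ℝ (a v) (b w) + inner ℝ (b v) (a w) := rfl

/-- The map `w ↦ ⟨w, a ·⟩`. -/
def transposeForm : (𝔼 m →L[ℝ] 𝔼 n) →L[ℝ] 𝔼 n →L[ℝ] 𝔼 m →L[ℝ] ℝ :=
  (ContinuousLinearMap.compL ℝ (𝔼 n) (𝔼 n →L[ℝ] ℝ) (𝔼 m →L[ℝ] ℝ)).flip (innerSL ℝ) ∘L
    (ContinuousLinearMap.compL ℝ (𝔼 m) (𝔼 n) ℝ).flip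

theorem transposeForm_apply (a : 𝔼 m →L[ℝ] 𝔼 n) (w : 𝔼 n) (v : 𝔼 m) :
    transposeForm a w v = inner ℝ w (a v) := rfl

/-- The Riesz representation of linear forms on Euclidean space. -/
def rieszMap : (𝔼 n →L[ℝ] ℝ) →L[ℝ] 𝔼 n :=
  ∑ i : Fin n, (ContinuousLinearMap.apply ℝ ℝ (EuclideanSpace.single i (1 : ℝ) : 𝔼 n)).smulRight
    (EuclideanSpace.single i (1 : ℝ) : 𝔼 n)

theorem rieszMap_apply (l : 𝔼 n →L[ℝ] ℝ) (i : Fin n) :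
    rieszMap l i = l (EuclideanSpace.single i (1 : ℝ)) := by
  simp [rieszMap, Pi.single_apply]

theorem inner_rieszMap (l : 𝔼 n →L[ℝ] ℝ) (w : 𝔼 n) : inner ℝ (rieszMap l) w = l w := by
  conv_rhs => rw [← (EuclideanSpace.basisFun (Fin n) ℝ).sum_repr w]
  simp [PiLp.inner_apply, rieszMap_apply]

/-- The lift `½ bᵀk` of a bilinear form `k` on `ℝᵐ` along `b : ℝⁿ → ℝᵐ`. -/
def liftBil : (𝔼 n →L[ℝ] 𝔼 m) →L[ℝ] (𝔼 m →L[ℝ] 𝔼 m →L[ℝ] ℝ) →L[ℝ] 𝔼 m →L[ℝ] 𝔼 n :=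
  (ContinuousLinearMap.compL ℝ (𝔼 m) (𝔼 m →L[ℝ] ℝ) (𝔼 n)).comp
    ((ContinuousLinearMap.compL ℝ (𝔼 m →L[ℝ] ℝ) (𝔼 n →L[ℝ] ℝ) (𝔼 n) ((1 / 2 : ℝ) • rieszMap)).comp
      (ContinuousLinearMap.compL ℝ (𝔼 n) (𝔼 m) ℝ).flip)

theorem liftBil_apply (b : 𝔼 n →L[ℝ] 𝔼 m) (k : 𝔼 m →L[ℝ] 𝔼 m →L[ℝ] ℝ) (v : 𝔼 m) :
    liftBil b k v = (1 / 2 : ℝ) • rieszMap ((k v).comp b) := rfl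

theorem inner_liftBil (b : 𝔼 n →L[ℝ] 𝔼 m) (k : 𝔼 m →L[ℝ] 𝔼 m →L[ℝ] ℝ) (v : 𝔼 m) (w : 𝔼 n) :
    inner ℝ (liftBil b k v) w = 1 / 2 * k v (b w) := by
  rw [liftBil_apply, real_inner_smul_left, inner_rieszMap]
  rfl

theorem injective_gramForm {a : 𝔼 m →L[ℝ] 𝔼 n} (ha : Function.Injective a) :
    Function.Injective (gramForm a) := by
  rw [injective_iff_map_eq_zero]
  intro v hv
  have h := gramForm_apply a v v
  rw [hv, _root_.zero_apply] at h
  exact (injective_iff_map_eq_zero a).1 ha v (inner_self_eq_zero.1 h.symm)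

/-- The isomorphism onto the dual space given by the Gram form of an injective linear map. -/
def gramEquiv {a : 𝔼 m →L[ℝ] 𝔼 n} (ha : Function.Injective a) : 𝔼 m ≃L[ℝ] (𝔼 m →L[ℝ] ℝ) :=
  (LinearEquiv.ofInjectiveOfFinrankEq (gramForm a : 𝔼 m →ₗ[ℝ] (𝔼 m →L[ℝ] ℝ))
    (injective_gramForm ha) (by
      rw [← LinearEquiv.finrank_eq (LinearMap.toContinuousLinearMap :
        (𝔼 m →ₗ[ℝ] ℝ) ≃ₗ[ℝ] (𝔼 m →L[ℝ] ℝ))]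
      exact Subspace.dual_finrank_eq.symm)).toContinuousLinearEquiv

theorem coe_gramEquiv {a : 𝔼 m →L[ℝ] 𝔼 n} (ha : Function.Injective a) :
    (gramEquiv ha : 𝔼 m →L[ℝ] (𝔼 m →L[ℝ] ℝ)) = gramForm a := by
  ext v w
  rfl

/-- The Moore–Penrose inverse `(aᵀa)⁻¹aᵀ` of an injective linear map `a`. -/
def pinv (a : 𝔼 m →L[ℝ] 𝔼 n) : 𝔼 n →L[ℝ] 𝔼 m :=
  (gramForm a).inverse.comp (transposeForm a)

theorem gramForm_pinv {a : 𝔼 m →L[ℝ] 𝔼 n} (ha : Function.Injective a) (w : 𝔼 n) :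
    gramForm a (pinv a w) = transposeForm a w := by
  rw [pinv, ← coe_gramEquiv ha, ContinuousLinearMap.inverse_equiv]
  exact (gramEquiv ha).apply_symm_apply _

theorem inner_pinv {a : 𝔼 m →L[ℝ] 𝔼 n} (ha : Function.Injective a) (w : 𝔼 n) (v : 𝔼 m) :
    inner ℝ (a (pinv a w)) (a v) = inner ℝ w (a v) := by
  rw [← gramForm_apply, gramForm_pinv ha, transposeForm_apply]

/-- The normal equations determine their solution since the Gram form is nondegenerate. All
identities for `pinv` that involve a change of frame come from this uniqueness. -/
theorem eq_pinv {a : 𝔼 m →L[ℝ] 𝔼 n} (ha : Function.Injective a) {w : 𝔼 n} {u : 𝔼 m}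
    (h : ∀ v, inner ℝ (a u) (a v) = inner ℝ w (a v)) : u = pinv a w := by
  refine injective_gramForm ha ?_
  ext v
  rw [gramForm_pinv ha, gramForm_apply, transposeForm_apply, h]

theorem pinv_apply_self {a : 𝔼 m →L[ℝ] 𝔼 n} (ha : Function.Injective a) (v : 𝔼 m) :
    pinv a (a v) = v :=
  (eq_pinv ha fun _ => rfl).symm

theorem pinv_comp {a : 𝔼 m →L[ℝ] 𝔼 n} (ha : Function.Injective a) {P : 𝔼 m →L[ℝ] 𝔼 m}
    (hP : Function.Bijective P) (w : 𝔼 n) : P (pinv (a.comp P) w) = pinv a w := by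
  refine eq_pinv ha fun v => ?_
  obtain ⟨v, rfl⟩ := hP.2 v
  exact inner_pinv (a := a.comp P) (ha.comp hP.1) w v

/-- Inversion is smooth at the isomorphism `gramForm a`, and `pinv a` is the product of that inverse
with a linear function of `a`. -/
theorem contDiffAt_pinv {a : 𝔼 m →L[ℝ] 𝔼 n} (ha : Function.Injective a) :
    ContDiffAt ℝ ∞ pinv a := by
  have h1 : ContDiffAt ℝ ∞ (ContinuousLinearMap.inverse :
      (𝔼 m →L[ℝ] 𝔼 m →L[ℝ] ℝ) → _) (gramForm a) := by
    rw [← coe_gramEquiv ha]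
    exact contDiffAt_map_inverse _
  exact (h1.comp a contDiff_gramForm.contDiffAt).clm_comp transposeForm.contDiff.contDiffAt

/-- By homogeneity positivity need only be tested on the unit sphere, which is compact. -/
theorem isOpen_posDef : IsOpen {k : 𝔼 m →L[ℝ] 𝔼 m →L[ℝ] ℝ | ∀ v, v ≠ 0 → 0 < k v v} := by
  have h : {k : 𝔼 m →L[ℝ] 𝔼 m →L[ℝ] ℝ | ∀ v, v ≠ 0 → 0 < k v v} =
      {k | ∀ v ∈ Metric.sphere (0 : 𝔼 m) 1, 0 < k v v} := by
    ext k
    refine ⟨fun h v hv => h v (ne_zero_of_mem_unit_sphere ⟨v, hv⟩), fun h v hv => ?_⟩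
    have hn : 0 < ‖v‖ := norm_pos_iff.2 hv
    have := h (‖v‖⁻¹ • v) (by simp [norm_smul, hn.ne'])
    simp only [map_smul, _root_.smul_apply, smul_eq_mul] at this
    have h2 := pos_of_mul_pos_right this (by positivity)
    exact pos_of_mul_pos_right h2 (by positivity)
  rw [h, isOpen_iff_eventually]
  intro k hk
  refine (isCompact_sphere (0 : 𝔼 m) 1).eventually_forall_of_forall_eventually fun v hv => ?_
  have hc : Continuous fun p : (𝔼 m →L[ℝ] 𝔼 m →L[ℝ] ℝ) × 𝔼 m => p.1 p.2 p.2 := by fun_prop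
  exact hc.continuousAt.eventually (lt_mem_nhds (hk v hv))

theorem isOpen_injective : IsOpen {a : 𝔼 m →L[ℝ] 𝔼 n | Function.Injective a} := by
  suffices e : {a : 𝔼 m →L[ℝ] 𝔼 n | Function.Injective a} =
      gramForm ⁻¹' {k : 𝔼 m →L[ℝ] 𝔼 m →L[ℝ] ℝ | ∀ v, v ≠ 0 → 0 < k v v} by
    rw [e]
    exact isOpen_posDef.preimage (contDiff_gramForm (m := m) (n := n)).continuous
  refine Set.ext fun a => ?_
  have h : ∀ v, 0 < gramForm a v v ↔ a v ≠ 0 := fun v => by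
    rw [gramForm_apply, real_inner_self_pos]
  change Function.Injective a ↔ ∀ v, v ≠ 0 → 0 < gramForm a v v
  rw [injective_iff_map_eq_zero]
  exact forall_congr' fun v => by rw [h, not_imp_not]

end LinearAlgebra

/-! ### The square root of a positive definite operator -/

section SquareRoot

variable {n : ℕ}

/-- The symmetric positive definite operators. -/
def posDefOperators (n : ℕ) : Set (𝔼 n →L[ℝ] 𝔼 n) :=
  {S | (∀ v w, inner ℝ (S v) w = inner ℝ v (S w)) ∧ ∀ v, v ≠ 0 → 0 < inner ℝ (S v) v}

/-- Diagonalize `Q` in an orthonormal eigenbasis and take the square roots of the eigenvalues. -/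
theorem exists_mul_self_eq {Q : 𝔼 n →L[ℝ] 𝔼 n} (hQ : Q ∈ posDefOperators n) :
    ∃ S ∈ posDefOperators n, S.comp S = Q := by
  have hs : (Q : 𝔼 n →ₗ[ℝ] 𝔼 n).IsSymmetric := hQ.1
  have hn : Module.finrank ℝ (𝔼 n) = n := by simp
  set e := hs.eigenvectorBasis hn
  set d := hs.eigenvalues hn
  have hd : ∀ i, 0 < d i := by
    intro i
    have h1 := hQ.2 (e i) (e.orthonormal.ne_zero i)
    have h2 : Q (e i) = d i • e i := hs.apply_eigenvectorBasis hn i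
    rw [h2, real_inner_smul_left, real_inner_self_eq_norm_sq, e.norm_eq_one] at h1
    simpa using h1
  set S : 𝔼 n →L[ℝ] 𝔼 n :=
    ∑ i, (innerSL ℝ (e i)).smulRight (√(d i) • e i) with hS
  have hSv : ∀ v w, inner ℝ (S v) w = ∑ i, √(d i) * (inner ℝ (e i) v * inner ℝ (e i) w) := by
    intro v w
    rw [hS, _root_.sum_apply, sum_inner]
    refine Finset.sum_congr rfl fun i _ => ?_
    rw [ContinuousLinearMap.smulRight_apply, real_inner_smul_left, real_inner_smul_left,
      innerSL_apply_apply]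
    ring
  have hSe : ∀ i, S (e i) = √(d i) • e i := by
    intro i
    refine InnerProductSpace.ext_inner_right_basis e.toBasis fun j => ?_
    rw [OrthonormalBasis.coe_toBasis, hSv, real_inner_smul_left]
    rw [Finset.sum_eq_single i]
    · simp
    · intro j _ hj
      simp [e.inner_eq_zero hj]
    · simp
  refine ⟨S, ⟨fun v w => ?_, fun v hv => ?_⟩, ?_⟩
  · rw [hSv, real_inner_comm (S w) v, hSv]
    exact Finset.sum_congr rfl fun i _ => by rw [mul_comm (inner ℝ (e i) v)]
  · rw [hSv]
    have h : ∃ i, inner ℝ (e i) v ≠ 0 := by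
      by_contra! h
      exact hv (InnerProductSpace.ext_inner_left_basis e.toBasis fun i => by
        rw [OrthonormalBasis.coe_toBasis, h, inner_zero_right])
    obtain ⟨i, hi⟩ := h
    refine Finset.sum_pos' (fun j _ => mul_nonneg (Real.sqrt_nonneg _) (mul_self_nonneg _))
      ⟨i, Finset.mem_univ _, mul_pos (Real.sqrt_pos.2 (hd i)) (mul_self_pos.2 hi)⟩
  · refine ContinuousLinearMap.coe_injective (e.toBasis.ext fun i => ?_)
    have h2 : Q (e i) = d i • e i := hs.apply_eigenvectorBasis hn i
    simp only [OrthonormalBasis.coe_toBasis, ContinuousLinearMap.coe_coe,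
      ContinuousLinearMap.comp_apply]
    rw [hSe, map_smul, hSe, h2, smul_smul, Real.mul_self_sqrt (hd i).le]

/-- On an eigenvector `e` of `B` with eigenvalue `d > 0` the equation reads `A (X e) = -d • X e`,
which contradicts positivity of `A` unless `X e = 0`. This gives both uniqueness of the square root
and invertibility of the differential of squaring. -/
theorem eq_zero_of_sylvester {A B X : 𝔼 n →L[ℝ] 𝔼 n} (hA : ∀ v, v ≠ 0 → 0 < inner ℝ (A v) v)
    (hB : B ∈ posDefOperators n) (h : A.comp X + X.comp B = 0) : X = 0 := by
  have hs : (B : 𝔼 n →ₗ[ℝ] 𝔼 n).IsSymmetric := hB.1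
  have hn : Module.finrank ℝ (𝔼 n) = n := by simp
  set e := hs.eigenvectorBasis hn
  refine ContinuousLinearMap.coe_injective (e.toBasis.ext fun i => ?_)
  have h2 : B (e i) = hs.eigenvalues hn i • e i := hs.apply_eigenvectorBasis hn i
  have h1 := hB.2 (e i) (e.orthonormal.ne_zero i)
  rw [h2, real_inner_smul_left, real_inner_self_eq_norm_sq, e.norm_eq_one] at h1
  have h3 : A (X (e i)) + hs.eigenvalues hn i • X (e i) = 0 := by
    rw [← map_smul, ← h2]
    exact DFunLike.congr_fun h (e i)
  by_contra hX
  have h4 := hA (X (e i)) (by simpa using hX)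
  have h5 : inner ℝ (A (X (e i)) + hs.eigenvalues hn i • X (e i)) (X (e i)) = 0 := by
    rw [h3, inner_zero_left]
  rw [inner_add_left, real_inner_smul_left] at h5
  have := real_inner_self_nonneg (x := X (e i))
  nlinarith

/-- If `A² = B²` then `A (A - B) + (A - B) B = 0`. -/
theorem eq_of_mul_self_eq {A B : 𝔼 n →L[ℝ] 𝔼 n} (hA : A ∈ posDefOperators n)
    (hB : B ∈ posDefOperators n) (h : A.comp A = B.comp B) : A = B := by
  rw [← sub_eq_zero]
  refine eq_zero_of_sylvester hA.2 hB ?_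
  rw [ContinuousLinearMap.comp_sub, ContinuousLinearMap.sub_comp, h]
  abel

open Classical in
/-- The positive definite square root of a positive definite operator. -/
def posSqrt (Q : 𝔼 n →L[ℝ] 𝔼 n) : 𝔼 n →L[ℝ] 𝔼 n :=
  if h : Q ∈ posDefOperators n then (exists_mul_self_eq h).choose else 0

theorem posSqrt_spec {Q : 𝔼 n →L[ℝ] 𝔼 n} (hQ : Q ∈ posDefOperators n) :
    posSqrt Q ∈ posDefOperators n ∧ (posSqrt Q).comp (posSqrt Q) = Q := by
  rw [posSqrt, dif_pos hQ]
  exact (exists_mul_self_eq hQ).choose_spec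

/-- The differential of `S ↦ S²` at a positive definite operator. -/
def squareDeriv {P : 𝔼 n →L[ℝ] 𝔼 n} (hP : P ∈ posDefOperators n) :
    (𝔼 n →L[ℝ] 𝔼 n) ≃L[ℝ] (𝔼 n →L[ℝ] 𝔼 n) :=
  (LinearEquiv.ofInjectiveEndo
    (((ContinuousLinearMap.compL ℝ (𝔼 n) (𝔼 n) (𝔼 n) P +
      (ContinuousLinearMap.compL ℝ (𝔼 n) (𝔼 n) (𝔼 n)).flip P) :
        (𝔼 n →L[ℝ] 𝔼 n) →L[ℝ] (𝔼 n →L[ℝ] 𝔼 n)) : (𝔼 n →L[ℝ] 𝔼 n) →ₗ[ℝ] (𝔼 n →L[ℝ] 𝔼 n))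
    ((injective_iff_map_eq_zero _).2 fun _ hX =>
      eq_zero_of_sylvester hP.2 hP hX)).toContinuousLinearEquiv

theorem hasFDerivAt_square {P : 𝔼 n →L[ℝ] 𝔼 n} (hP : P ∈ posDefOperators n) :
    HasFDerivAt (fun S : 𝔼 n →L[ℝ] 𝔼 n => S.comp S)
      (squareDeriv hP : (𝔼 n →L[ℝ] 𝔼 n) →L[ℝ] (𝔼 n →L[ℝ] 𝔼 n)) P :=
  (hasFDerivAt_id P).clm_comp (hasFDerivAt_id P)

/-- The inverse function theorem gives a smooth local inverse `g` of squaring near `P = posSqrt Q`.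
For positive definite `q` near `Q`, `g q` is symmetric and positive, hence equals `posSqrt q` by
uniqueness. Smoothness is claimed only within the positive definite operators, since `posSqrt` takes
the default value 0 elsewhere. -/
theorem contDiffWithinAt_posSqrt {Q : 𝔼 n →L[ℝ] 𝔼 n} (hQ : Q ∈ posDefOperators n) :
    ContDiffWithinAt ℝ ∞ posSqrt (posDefOperators n) Q := by
  obtain ⟨hP, hPQ⟩ := posSqrt_spec hQ
  set P := posSqrt Q with hPdef
  have hf : ContDiffAt ℝ ∞ (fun S : 𝔼 n →L[ℝ] 𝔼 n => S.comp S) P :=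
    contDiffAt_id.clm_comp contDiffAt_id
  have hn : (∞ : WithTop ℕ∞) ≠ 0 := by simp
  set g := hf.localInverse (hasFDerivAt_square hP) hn with hg
  have hgs : ContDiffAt ℝ ∞ g Q := by
    rw [← hPQ]
    exact hf.to_localInverse (hasFDerivAt_square hP) hn
  have hst := hf.hasStrictFDerivAt' (hasFDerivAt_square hP) hn
  have hgP : g Q = P := by
    have := hst.localInverse_apply_image
    rw [hPQ] at this
    exact this
  have hr : ∀ᶠ q in 𝓝 Q, (g q).comp (g q) = q := by
    have := hst.eventually_right_inverse
    rw [hPQ] at this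
    exact this
  have hl : ∀ᶠ S in 𝓝 P, g (S.comp S) = S := hst.eventually_left_inverse
  have hgt : Tendsto g (𝓝 Q) (𝓝 P) := by
    have := hgs.continuousAt.tendsto
    rwa [hgP] at this
  have hadj : Tendsto (fun S : 𝔼 n →L[ℝ] 𝔼 n => ContinuousLinearMap.adjoint S) (𝓝 P) (𝓝 P) := by
    have h : ContinuousLinearMap.adjoint P = P :=
      ((ContinuousLinearMap.eq_adjoint_iff P P).2 hP.1).symm
    have := (ContinuousLinearMap.adjoint (𝕜 := ℝ) (E := 𝔼 n) (F := 𝔼 n)).continuous.tendsto P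
    rwa [h] at this
  have hpos : ∀ᶠ S in 𝓝 P, ∀ v, v ≠ 0 → 0 < inner ℝ (S v) v := by
    have h : IsOpen {S : 𝔼 n →L[ℝ] 𝔼 n | ∀ v, v ≠ 0 → 0 < inner ℝ (S v) v} :=
      isOpen_posDef.preimage ((innerBil (m := n) (n := n)).flip (ContinuousLinearMap.id ℝ (𝔼 n))).continuous
    exact h.mem_nhds hP.2
  refine hgs.contDiffWithinAt.congr_of_eventuallyEq ?_ ?_
  · filter_upwards [self_mem_nhdsWithin, nhdsWithin_le_nhds hr,
      nhdsWithin_le_nhds (hgt.eventually hl), nhdsWithin_le_nhds (hgt.eventually (hadj.eventually hl)),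
      nhdsWithin_le_nhds (hgt.eventually hpos)] with q hq h1 h2 h3 h4
    have hqa : ContinuousLinearMap.adjoint q = q :=
      ((ContinuousLinearMap.eq_adjoint_iff q q).2 hq.1).symm
    -- The adjoint of `g q` also squares to `q` and is also close to `P`, so local injectivity of
    -- squaring makes `g q` self-adjoint.
    rw [← ContinuousLinearMap.adjoint_comp, h1, hqa] at h3
    refine eq_of_mul_self_eq (posSqrt_spec hq).1 ⟨?_, h4⟩ ((posSqrt_spec hq).2.trans h1.symm)
    exact (ContinuousLinearMap.eq_adjoint_iff _ _).1 h3
  · rw [hgP]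

attribute [irreducible] innerBil symBil rieszMap liftBil transposeForm pinv posSqrt

end SquareRoot

/-! ### Convergence of smooth sections -/

section SectionConvergence

variable {E : Type*} [NormedAddCommGroup E] [NormedSpace ℝ E]
  {H : Type*} [TopologicalSpace H] {I : ModelWithCorners ℝ E H}
  {M : Type*} [TopologicalSpace M] [ChartedSpace H M]

theorem symm_mem_chart_source {x₀ : M} {y : E} (hy : y ∈ (extChartAt I x₀).target) :
    (extChartAt I x₀).symm y ∈ (chartAt H x₀).source := by
  rw [← extChartAt_source I]
  exact (extChartAt I x₀).map_target hy

variable {F : Type*} [NormedAddCommGroup F] [NormedSpace ℝ F]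
  {V : M → Type*} [TopologicalSpace (TotalSpace F V)] [∀ x, TopologicalSpace (V x)]
  [FiberBundle F V]

/-- When the trivialization covers the whole chart domain, every compact subset of the chart target
is admissible in `localCompacts`. -/
theorem tendsto_section_iff (hV : ∀ x₀ : M, (chartAt H x₀).source ⊆ (trivializationAt F V x₀).baseSet)
    {ι : Type*} {l : Filter ι} {s : ι → Cₛ^∞⟮I; F, V⟯} {t : Cₛ^∞⟮I; F, V⟯} :
    Tendsto s l (𝓝 t) ↔ ∀ x₀ : M, SmoothTendsto (extChartAt I x₀).target l
      (fun i => sectionLocalRep (s i) x₀) (sectionLocalRep t x₀) := by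
  have hK : ∀ (x₀ : M) (K : Set E), K ∈ localCompacts I F V x₀ ↔
      K ⊆ (extChartAt I x₀).target ∧ IsCompact K := by
    intro x₀ K
    refine ⟨fun h => ⟨h.2.trans inter_subset_left, h.1⟩, fun h => ⟨h.2, fun y hy =>
      ⟨h.1 hy, hV x₀ ?_⟩⟩⟩
    rw [← extChartAt_source I]
    exact (extChartAt I x₀).map_target (h.1 hy)
  simp only [nhds_iInf, nhds_induced, tendsto_iInf, tendsto_comap_iff]
  refine forall_congr' fun x₀ => forall_congr' fun k => ?_
  rw [UniformOnFun.tendsto_iff_tendstoUniformlyOn]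
  refine forall_congr' fun K => ?_
  rw [hK, and_imp]
  rfl

theorem contDiffOn_sectionLocalRep [IsManifold I ∞ M] [∀ x, AddCommGroup (V x)]
    [∀ x, Module ℝ (V x)] [VectorBundle ℝ F V] [ContMDiffVectorBundle ∞ F V I]
    (hV : ∀ x₀ : M, (chartAt H x₀).source ⊆ (trivializationAt F V x₀).baseSet)
    (s : Cₛ^∞⟮I; F, V⟯) (x₀ : M) :
    ContDiffOn ℝ ∞ (sectionLocalRep s x₀) (extChartAt I x₀).target := by
  have h := ((trivializationAt F V x₀).contMDiffOn_section_iff (chartAt H x₀).open_source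
    (hV x₀)).1 s.contMDiff.contMDiffOn
  rw [← contMDiffOn_iff_contDiffOn]
  refine h.comp (contMDiffOn_extChartAt_symm x₀) fun y hy => ?_
  rw [mem_preimage, ← extChartAt_source I]
  exact (extChartAt I x₀).map_target hy

end SectionConvergence

/-! ### One-forms and tensor fields in coordinates -/

section Coordinates

variable {m n : ℕ} {H : Type*} [TopologicalSpace H] {I : ModelWithCorners ℝ (𝔼 m) H}
  {M : Type*} [TopologicalSpace M] [ChartedSpace H M] [IsManifold I ∞ M]

variable (I) in
/-- The frame of coordinate vector fields of the chart at `x₀`, at the point `x`. -/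
def coordFrame (x₀ x : M) : 𝔼 m →L[ℝ] 𝔼 m :=
  (trivializationAt (𝔼 m) (TangentSpace I : M → Type _) x₀).symmL ℝ x

theorem bijective_coordFrame {x₀ x : M} (hx : x ∈ (chartAt H x₀).source) :
    Function.Bijective (coordFrame I x₀ x) := by
  have h := Trivialization.symm_continuousLinearEquivAt_eq (R := ℝ)
    (trivializationAt (𝔼 m) (TangentSpace I : M → Type _) x₀) hx
  have h2 : (coordFrame I x₀ x : 𝔼 m → 𝔼 m) = ((trivializationAt (𝔼 m)
      (TangentSpace I : M → Type _) x₀).continuousLinearEquivAt ℝ x hx).symm :=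
    funext fun v => (congr_fun h v).symm
  rw [h2]
  exact ((trivializationAt (𝔼 m) (TangentSpace I : M → Type _) x₀).continuousLinearEquivAt ℝ x
    hx).symm.bijective

/-- The bilinear form `k (P v) (P w)`. -/
def pullForm (P : 𝔼 m →L[ℝ] 𝔼 m) (k : 𝔼 m →L[ℝ] 𝔼 m →L[ℝ] ℝ) : 𝔼 m →L[ℝ] 𝔼 m →L[ℝ] ℝ :=
  k.bilinearComp P P

theorem pullForm_apply (P : 𝔼 m →L[ℝ] 𝔼 m) (k : 𝔼 m →L[ℝ] 𝔼 m →L[ℝ] ℝ) (v w : 𝔼 m) :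
    pullForm P k v w = k (P v) (P w) := rfl

/-- A linear map on the tangent space `T_x M`, regarded as a linear map on `ℝᵐ`. -/
def formVal {x : M} (a : TangentSpace I x →L[ℝ] 𝔼 n) : 𝔼 m →L[ℝ] 𝔼 n := a

/-- A bilinear form on the tangent space `T_x M`, regarded as a bilinear form on `ℝᵐ`. -/
def tensorVal {x : M} (k : TangentSpace I x →L[ℝ] TangentSpace I x →L[ℝ] ℝ) :
    𝔼 m →L[ℝ] 𝔼 m →L[ℝ] ℝ := k

theorem chart_subset_baseSet_oneForm (x₀ : M) : (chartAt H x₀).source ⊆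
    (trivializationAt (𝔼 m →L[ℝ] 𝔼 n)
      (fun x : M => TangentSpace I x →L[ℝ] 𝔼 n) x₀).baseSet := by
  rw [hom_trivializationAt_baseSet]
  exact fun x hx => ⟨hx, mem_univ _⟩

theorem chart_subset_baseSet_tensor (x₀ : M) : (chartAt H x₀).source ⊆
    (trivializationAt (𝔼 m →L[ℝ] 𝔼 m →L[ℝ] ℝ)
      (fun x : M => TangentSpace I x →L[ℝ] TangentSpace I x →L[ℝ] ℝ) x₀).baseSet := by
  rw [hom_trivializationAt_baseSet, hom_trivializationAt_baseSet]
  exact fun x hx => ⟨hx, hx, mem_univ _⟩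

theorem trivialization_oneForm (x₀ x : M) (a : TangentSpace I x →L[ℝ] 𝔼 n) :
    (trivializationAt (𝔼 m →L[ℝ] 𝔼 n) (fun x : M => TangentSpace I x →L[ℝ] 𝔼 n) x₀ ⟨x, a⟩).2 =
      (formVal a).comp (coordFrame I x₀ x) := by
  rw [hom_trivializationAt_apply]
  refine ContinuousLinearMap.ext fun v => ?_
  simp [ContinuousLinearMap.inCoordinates]
  rfl

theorem trivialization_tensor {x₀ x : M} (hx : x ∈ (chartAt H x₀).source)
    (k : TangentSpace I x →L[ℝ] TangentSpace I x →L[ℝ] ℝ) :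
    (trivializationAt (𝔼 m →L[ℝ] 𝔼 m →L[ℝ] ℝ)
      (fun x : M => TangentSpace I x →L[ℝ] TangentSpace I x →L[ℝ] ℝ) x₀ ⟨x, k⟩).2 =
      pullForm (coordFrame I x₀ x) (tensorVal k) := by
  rw [hom_trivializationAt_apply]
  ext v w
  have hx' : x ∈ (trivializationAt (𝔼 m) (TangentSpace I : M → Type _) x₀).baseSet := hx
  rw [inCoordinates_apply_eq₂ hx' hx' (by simp)]
  have h : ∀ u, (trivializationAt (𝔼 m) (TangentSpace I : M → Type _) x₀).symm x u =
    coordFrame I x₀ x u := fun u => (Trivialization.symmL_apply _ hx' u).symm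
  rw [h, h]
  simp
  rfl

/-- In the trivialization at `x₀` a one-form becomes its composition with the coordinate frame, so
bundle smoothness reduces to that of operator-valued functions. -/
theorem contMDiff_oneForm_iff {σ : ∀ x : M, TangentSpace I x →L[ℝ] 𝔼 n} :
    ContMDiff I (I.prod 𝓘(ℝ, 𝔼 m →L[ℝ] 𝔼 n)) ∞ (fun x => TotalSpace.mk' (𝔼 m →L[ℝ] 𝔼 n)
      (E := fun x : M => TangentSpace I x →L[ℝ] 𝔼 n) x (σ x)) ↔
    ∀ x₀ : M, ContMDiffOn I 𝓘(ℝ, 𝔼 m →L[ℝ] 𝔼 n) ∞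
      (fun x => (formVal (σ x)).comp (coordFrame I x₀ x)) (chartAt H x₀).source := by
  have h : ∀ x₀ : M, _ := fun x₀ =>
    (trivializationAt (𝔼 m →L[ℝ] 𝔼 n) (fun x : M => TangentSpace I x →L[ℝ] 𝔼 n)
      x₀).contMDiffOn_section_iff (IB := I) (n := ∞) (s := σ) (chartAt H x₀).open_source
      (chart_subset_baseSet_oneForm x₀)
  simp only [trivialization_oneForm] at h
  refine ⟨fun hs x₀ => (h x₀).1 hs.contMDiffOn, fun hs x₀ => ?_⟩
  exact ((h x₀).2 (hs x₀)).contMDiffAt ((chartAt H x₀).open_source.mem_nhds (mem_chart_source H x₀))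

theorem contMDiff_tensor_iff {σ : ∀ x : M, TangentSpace I x →L[ℝ] TangentSpace I x →L[ℝ] ℝ} :
    ContMDiff I (I.prod 𝓘(ℝ, 𝔼 m →L[ℝ] 𝔼 m →L[ℝ] ℝ)) ∞
      (fun x => TotalSpace.mk' (𝔼 m →L[ℝ] 𝔼 m →L[ℝ] ℝ)
      (E := fun x : M => TangentSpace I x →L[ℝ] TangentSpace I x →L[ℝ] ℝ) x (σ x)) ↔
    ∀ x₀ : M, ContMDiffOn I 𝓘(ℝ, 𝔼 m →L[ℝ] 𝔼 m →L[ℝ] ℝ) ∞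
      (fun x => pullForm (coordFrame I x₀ x) (tensorVal (σ x))) (chartAt H x₀).source := by
  have h : ∀ x₀ : M, _ := fun x₀ =>
    (trivializationAt (𝔼 m →L[ℝ] 𝔼 m →L[ℝ] ℝ)
      (fun x : M => TangentSpace I x →L[ℝ] TangentSpace I x →L[ℝ] ℝ)
      x₀).contMDiffOn_section_iff (IB := I) (n := ∞) (s := σ) (chartAt H x₀).open_source
      (chart_subset_baseSet_tensor x₀)
  have e : ∀ x₀ : M, _ := fun x₀ => contMDiffOn_congr (I := I)
    (I' := 𝓘(ℝ, 𝔼 m →L[ℝ] 𝔼 m →L[ℝ] ℝ)) (n := ∞) (s := (chartAt H x₀).source)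
    fun x hx => trivialization_tensor (x₀ := x₀) hx (σ x)
  refine ⟨fun hs x₀ => (e x₀).1 ((h x₀).1 hs.contMDiffOn), fun hs x₀ => ?_⟩
  exact ((h x₀).2 ((e x₀).2 (hs x₀))).contMDiffAt
    ((chartAt H x₀).open_source.mem_nhds (mem_chart_source H x₀))

theorem contMDiffOn_oneForm (α : OneForm I M n) (x₀ : M) :
    ContMDiffOn I 𝓘(ℝ, 𝔼 m →L[ℝ] 𝔼 n) ∞
      (fun x => (formVal (α x)).comp (coordFrame I x₀ x)) (chartAt H x₀).source :=
  contMDiff_oneForm_iff.1 α.contMDiff x₀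

theorem contMDiffOn_tensor (k : Tensor02 I M) (x₀ : M) :
    ContMDiffOn I 𝓘(ℝ, 𝔼 m →L[ℝ] 𝔼 m →L[ℝ] ℝ) ∞
      (fun x => pullForm (coordFrame I x₀ x) (tensorVal (k x))) (chartAt H x₀).source :=
  contMDiff_tensor_iff.1 k.contMDiff x₀

theorem sectionLocalRep_oneForm (α : OneForm I M n) (x₀ : M) (y : 𝔼 m) :
    sectionLocalRep α x₀ y = (formVal (α ((extChartAt I x₀).symm y))).comp
      (coordFrame I x₀ ((extChartAt I x₀).symm y)) :=
  trivialization_oneForm x₀ _ _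

theorem sectionLocalRep_tensor (k : Tensor02 I M) (x₀ : M) {y : 𝔼 m}
    (hy : y ∈ (extChartAt I x₀).target) :
    sectionLocalRep k x₀ y = pullForm (coordFrame I x₀ ((extChartAt I x₀).symm y))
      (tensorVal (k ((extChartAt I x₀).symm y))) :=
  trivialization_tensor (symm_mem_chart_source hy) _

theorem contDiffOn_rep_oneForm (α : OneForm I M n) (x₀ : M) :
    ContDiffOn ℝ ∞ (sectionLocalRep α x₀) (extChartAt I x₀).target :=
  contDiffOn_sectionLocalRep chart_subset_baseSet_oneForm α x₀

theorem contDiffOn_rep_tensor (k : Tensor02 I M) (x₀ : M) :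
    ContDiffOn ℝ ∞ (sectionLocalRep k x₀) (extChartAt I x₀).target :=
  contDiffOn_sectionLocalRep chart_subset_baseSet_tensor k x₀

theorem tendsto_oneForm_iff {ι : Type*} {l : Filter ι} {s : ι → OneForm I M n}
    {t : OneForm I M n} : Tendsto s l (𝓝 t) ↔ ∀ x₀ : M, SmoothTendsto (extChartAt I x₀).target l
      (fun i => sectionLocalRep (s i) x₀) (sectionLocalRep t x₀) :=
  tendsto_section_iff chart_subset_baseSet_oneForm

theorem tendsto_symTensor_iff {ι : Type*} {l : Filter ι} {s : ι → SymTensor I M}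
    {t : SymTensor I M} : Tendsto s l (𝓝 t) ↔ ∀ x₀ : M, SmoothTendsto (extChartAt I x₀).target l
      (fun i => sectionLocalRep (s i).1 x₀) (sectionLocalRep t.1 x₀) := by
  rw [tendsto_subtype_rng]
  exact tendsto_section_iff chart_subset_baseSet_tensor

theorem pullForm_add (P : 𝔼 m →L[ℝ] 𝔼 m) (h k : 𝔼 m →L[ℝ] 𝔼 m →L[ℝ] ℝ) :
    pullForm P (h + k) = pullForm P h + pullForm P k := rfl

theorem pullForm_smul (P : 𝔼 m →L[ℝ] 𝔼 m) (c : ℝ) (k : 𝔼 m →L[ℝ] 𝔼 m →L[ℝ] ℝ) :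
    pullForm P (c • k) = c • pullForm P k := rfl

attribute [irreducible] pullForm

end Coordinates

/-! ### Behaviour of lifts and of the transition operator under change of frame -/

section LiftAlgebra

variable {m n : ℕ}

/-- Paired with `w`, both sides at `v` give `½ k (P v) (pinv a w)`. This naturality makes the
pointwise lift a smooth section and lets its continuity be checked in charts. -/
theorem liftBil_comp {a : 𝔼 m →L[ℝ] 𝔼 n} (ha : Function.Injective a) {P : 𝔼 m →L[ℝ] 𝔼 m}
    (hP : Function.Bijective P) (k : 𝔼 m →L[ℝ] 𝔼 m →L[ℝ] ℝ) :
    (liftBil (pinv a) k).comp P = liftBil (pinv (a.comp P)) (pullForm P k) := by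
  refine ContinuousLinearMap.ext fun v => ext_inner_right ℝ fun w => ?_
  rw [ContinuousLinearMap.comp_apply, inner_liftBil, inner_liftBil, pullForm_apply,
    pinv_comp ha hP]

/-- Since `pinv a` inverts `a` on the left, each of the two terms contributes `½ k`; symmetry of `k`
makes them equal. -/
theorem symBil_liftBil {a : 𝔼 m →L[ℝ] 𝔼 n} (ha : Function.Injective a)
    {k : 𝔼 m →L[ℝ] 𝔼 m →L[ℝ] ℝ} (hk : ∀ v w, k v w = k w v) :
    symBil a (liftBil (pinv a) k) = k := by
  ext v w
  rw [symBil_apply, inner_liftBil, real_inner_comm, inner_liftBil, pinv_apply_self ha,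
    pinv_apply_self ha, hk w v]
  ring

theorem symBil_symm (a b : 𝔼 m →L[ℝ] 𝔼 n) (v w : 𝔼 m) : symBil a b v w = symBil a b w v := by
  rw [symBil_apply, symBil_apply, real_inner_comm, add_comm, real_inner_comm (a w)]

theorem symBil_comm (a b : 𝔼 m →L[ℝ] 𝔼 n) : symBil a b = symBil b a := by
  ext v w
  rw [symBil_apply, symBil_apply, add_comm]

theorem symBil_comp (a b : 𝔼 m →L[ℝ] 𝔼 n) (P : 𝔼 m →L[ℝ] 𝔼 m) :
    pullForm P (symBil a b) = symBil (a.comp P) (b.comp P) := by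
  ext v w
  rw [pullForm_apply, symBil_apply, symBil_apply]
  rfl

theorem posDef_pullForm_iff {P : 𝔼 m →L[ℝ] 𝔼 m} (hP : Function.Bijective P)
    (k : 𝔼 m →L[ℝ] 𝔼 m →L[ℝ] ℝ) :
    (∀ v, v ≠ 0 → 0 < pullForm P k v v) ↔ ∀ v, v ≠ 0 → 0 < k v v := by
  simp only [pullForm_apply]
  refine ⟨fun h v hv => ?_, fun h v hv => h (P v) ?_⟩
  · obtain ⟨v, rfl⟩ := hP.2 v
    exact h v fun h0 => hv (by rw [h0, map_zero])
  · exact fun h0 => hv (hP.1 (by rw [h0, map_zero]))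

/-- The positive definite operator `bᵀkb + 1 - ab` on `ℝⁿ`, where `b = (aᵀa)⁻¹aᵀ`. -/
def transitionOp (a : 𝔼 m →L[ℝ] 𝔼 n) (k : 𝔼 m →L[ℝ] 𝔼 m →L[ℝ] ℝ) : 𝔼 n →L[ℝ] 𝔼 n :=
  (2 : ℝ) • (liftBil (pinv a) k).comp (pinv a) + ContinuousLinearMap.id ℝ (𝔼 n) - a.comp (pinv a)

/-- The last term takes this symmetric form because `a (pinv a)` is an orthogonal projection. -/
theorem inner_transitionOp {a : 𝔼 m →L[ℝ] 𝔼 n} (ha : Function.Injective a)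
    (k : 𝔼 m →L[ℝ] 𝔼 m →L[ℝ] ℝ) (w u : 𝔼 n) :
    inner ℝ (transitionOp a k w) u = k (pinv a w) (pinv a u) + inner ℝ w u -
      inner ℝ (a (pinv a w)) (a (pinv a u)) := by
  have h : inner ℝ (a (pinv a w)) u = inner ℝ (a (pinv a w)) (a (pinv a u)) := by
    rw [real_inner_comm, ← inner_pinv ha, real_inner_comm]
  have e : transitionOp a k w =
      (2 : ℝ) • liftBil (pinv a) k (pinv a w) + w - a (pinv a w) := rfl
  rw [e, inner_sub_left, inner_add_left, real_inner_smul_left, inner_liftBil, h]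
  ring

/-- With `b = pinv a`, the quadratic form is `k (b w) (b w) + ‖w - a b w‖²`. If `b w = 0` it equals
`‖w‖²`; otherwise the first term is positive. -/
theorem transitionOp_mem {a : 𝔼 m →L[ℝ] 𝔼 n} (ha : Function.Injective a)
    {k : 𝔼 m →L[ℝ] 𝔼 m →L[ℝ] ℝ} (hk : ∀ v w, k v w = k w v) (hpos : ∀ v, v ≠ 0 → 0 < k v v) :
    transitionOp a k ∈ posDefOperators n := by
  refine ⟨fun w u => ?_, fun w hw => ?_⟩
  · rw [inner_transitionOp ha, real_inner_comm (transitionOp a k u) w, inner_transitionOp ha, hk,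
      real_inner_comm (a (pinv a w)), real_inner_comm w]
  · rw [inner_transitionOp ha]
    by_cases h : pinv a w = 0
    · rw [h, map_zero, map_zero, inner_zero_left, zero_add, sub_zero]
      exact real_inner_self_pos.2 hw
    · have h1 := hpos _ h
      have h2 : inner ℝ w (a (pinv a w)) = inner ℝ (a (pinv a w)) (a (pinv a w)) :=
        (inner_pinv ha _ _).symm
      have h3 := real_inner_self_nonneg (x := w - a (pinv a w))
      rw [inner_sub_left, inner_sub_right, inner_sub_right, h2,
        real_inner_comm w (a (pinv a w)), h2] at h3
      linarith

theorem inner_transitionOp_range {a : 𝔼 m →L[ℝ] 𝔼 n} (ha : Function.Injective a)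
    (k : 𝔼 m →L[ℝ] 𝔼 m →L[ℝ] ℝ) (v w : 𝔼 m) :
    inner ℝ (transitionOp a k (a v)) (a w) = k v w := by
  rw [inner_transitionOp ha, pinv_apply_self ha, pinv_apply_self ha]
  ring

/-- The operator lives on `ℝⁿ` and sees the tangent space only through `pinv` and `k`, whose frame
changes cancel. It may thus be computed in any chart. -/
theorem transitionOp_comp {a : 𝔼 m →L[ℝ] 𝔼 n} (ha : Function.Injective a) {P : 𝔼 m →L[ℝ] 𝔼 m}
    (hP : Function.Bijective P) (k : 𝔼 m →L[ℝ] 𝔼 m →L[ℝ] ℝ) :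
    transitionOp (a.comp P) (pullForm P k) = transitionOp a k := by
  refine ContinuousLinearMap.ext fun w => ext_inner_right ℝ fun u => ?_
  rw [inner_transitionOp ha, inner_transitionOp (a := a.comp P) (ha.comp hP.1), pullForm_apply,
    pinv_comp ha hP, pinv_comp ha hP, ContinuousLinearMap.comp_apply,
    ContinuousLinearMap.comp_apply, pinv_comp ha hP, pinv_comp ha hP]

/-- For the symmetric root `S` one has `⟨S a v, S a w⟩ = ⟨S² a v, a w⟩ = k v w`. -/
theorem gramForm_posSqrt_transitionOp {a : 𝔼 m →L[ℝ] 𝔼 n} (ha : Function.Injective a)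
    {k : 𝔼 m →L[ℝ] 𝔼 m →L[ℝ] ℝ} (hk : ∀ v w, k v w = k w v) (hpos : ∀ v, v ≠ 0 → 0 < k v v) :
    gramForm ((posSqrt (transitionOp a k)).comp a) = k := by
  obtain ⟨h1, h2⟩ := posSqrt_spec (transitionOp_mem ha hk hpos)
  ext v w
  rw [gramForm_apply, ContinuousLinearMap.comp_apply, ContinuousLinearMap.comp_apply, ← h1.1,
    ← ContinuousLinearMap.comp_apply, h2, inner_transitionOp_range ha]

theorem transitionOp_def (a : 𝔼 m →L[ℝ] 𝔼 n) (k : 𝔼 m →L[ℝ] 𝔼 m →L[ℝ] ℝ) :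
    transitionOp a k = (2 : ℝ) • (liftBil (pinv a) k).comp (pinv a) +
      ContinuousLinearMap.id ℝ (𝔼 n) - a.comp (pinv a) := rfl

attribute [irreducible] transitionOp

end LiftAlgebra

/-! ### The differential of `α ↦ αᵀα` and its right inverse -/

theorem contMDiffOn_bilin {E : Type*} [NormedAddCommGroup E] [NormedSpace ℝ E]
    {H : Type*} [TopologicalSpace H] {I : ModelWithCorners ℝ E H}
    {M : Type*} [TopologicalSpace M] [ChartedSpace H M]
    {A : Type*} [NormedAddCommGroup A] [NormedSpace ℝ A]
    {A' : Type*} [NormedAddCommGroup A'] [NormedSpace ℝ A']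
    {C : Type*} [NormedAddCommGroup C] [NormedSpace ℝ C] (B : A →L[ℝ] A' →L[ℝ] C)
    {f : M → A} {g : M → A'} {s : Set M} (hf : ContMDiffOn I 𝓘(ℝ, A) ∞ f s)
    (hg : ContMDiffOn I 𝓘(ℝ, A') ∞ g s) :
    ContMDiffOn I 𝓘(ℝ, C) ∞ (fun x => B (f x) (g x)) s :=
  (B.isBoundedBilinearMap.contDiff.contMDiff (n := ∞)).comp_contMDiffOn (hf.prodMk_space hg)

section Submersion

variable {m n : ℕ} {H : Type*} [TopologicalSpace H] {I : ModelWithCorners ℝ (𝔼 m) H}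
  {M : Type*} [TopologicalSpace M] [ChartedSpace H M] [IsManifold I ∞ M]

/-- A symmetric tensor field in the coordinates at `x₀`. -/
def symRep (k : SymTensor I M) (x₀ : M) : 𝔼 m → 𝔼 m →L[ℝ] 𝔼 m →L[ℝ] ℝ :=
  sectionLocalRep k.1 x₀

theorem symRep_def (k : SymTensor I M) (x₀ : M) : symRep k x₀ = sectionLocalRep k.1 x₀ := rfl

theorem symRep_apply (k : SymTensor I M) (x₀ : M) {y : 𝔼 m}
    (hy : y ∈ (extChartAt I x₀).target) :
    symRep k x₀ y = pullForm (coordFrame I x₀ ((extChartAt I x₀).symm y))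
      (tensorVal (k.1 ((extChartAt I x₀).symm y))) :=
  sectionLocalRep_tensor k.1 x₀ hy

theorem contDiffOn_symRep (k : SymTensor I M) (x₀ : M) :
    ContDiffOn ℝ ∞ (symRep k x₀) (extChartAt I x₀).target :=
  contDiffOn_rep_tensor k.1 x₀

attribute [irreducible] symRep

/-- A one-form in the coordinates at `x₀`. -/
def formRep (α : OneForm I M n) (x₀ : M) : 𝔼 m → 𝔼 m →L[ℝ] 𝔼 n :=
  sectionLocalRep α x₀

theorem formRep_def (α : OneForm I M n) (x₀ : M) : formRep α x₀ = sectionLocalRep α x₀ := rfl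

theorem formRep_apply (α : OneForm I M n) (x₀ : M) (y : 𝔼 m) :
    formRep α x₀ y = (formVal (α ((extChartAt I x₀).symm y))).comp
      (coordFrame I x₀ ((extChartAt I x₀).symm y)) :=
  sectionLocalRep_oneForm α x₀ y

theorem contDiffOn_formRep (α : OneForm I M n) (x₀ : M) :
    ContDiffOn ℝ ∞ (formRep α x₀) (extChartAt I x₀).target :=
  contDiffOn_rep_oneForm α x₀

attribute [irreducible] formRep

theorem continuous_symTensor_iff {Z : Type*} [TopologicalSpace Z] {s : Z → SymTensor I M} :
    Continuous s ↔ ∀ z x₀, SmoothTendsto (extChartAt I x₀).target (𝓝 z)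
      (fun i => symRep (s i) x₀) (symRep (s z) x₀) :=
  continuous_iff_continuousAt.trans (forall_congr' fun _ => by
    simp only [symRep_def]
    exact tendsto_symTensor_iff)

theorem continuous_oneForm_iff {Z : Type*} [TopologicalSpace Z] {s : Z → OneForm I M n} :
    Continuous s ↔ ∀ z x₀, SmoothTendsto (extChartAt I x₀).target (𝓝 z)
      (fun i => formRep (s i) x₀) (formRep (s z) x₀) :=
  continuous_iff_continuousAt.trans (forall_congr' fun _ => by
    simp only [formRep_def]
    exact tendsto_oneForm_iff)

theorem symRep_add (h k : SymTensor I M) (x₀ : M) :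
    EqOn (symRep (h + k) x₀) (fun y => symRep h x₀ y + symRep k x₀ y)
      (extChartAt I x₀).target := by
  intro y hy
  simp only [symRep_apply _ _ hy]
  exact pullForm_add _ _ _

theorem symRep_smul (c : ℝ) (k : SymTensor I M) (x₀ : M) :
    EqOn (symRep (c • k) x₀)
      (fun y => ContinuousLinearMap.lsmul ℝ ℝ c (symRep k x₀ y))
      (extChartAt I x₀).target := by
  intro y hy
  simp only [symRep_apply _ _ hy]
  exact pullForm_smul _ _ _

instance symTensorContinuousAdd : ContinuousAdd (SymTensor I M) := by
  constructor
  rw [continuous_symTensor_iff]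
  intro p x₀
  have h1 := continuous_symTensor_iff.1 continuous_fst p x₀
  have h2 := continuous_symTensor_iff.1 continuous_snd p x₀
  have h := SmoothTendsto.add (uniqueDiffOn_extChartAt_target x₀)
    (fun q : SymTensor I M × SymTensor I M => contDiffOn_symRep q.1 x₀) (contDiffOn_symRep p.1 x₀)
    (fun q : SymTensor I M × SymTensor I M => contDiffOn_symRep q.2 x₀) (contDiffOn_symRep p.2 x₀)
    h1 h2
  exact h.congr (fun q : SymTensor I M × SymTensor I M => symRep_add q.1 q.2 x₀) (symRep_add _ _ x₀)

instance symTensorContinuousSMul : ContinuousSMul ℝ (SymTensor I M) := by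
  constructor
  rw [continuous_symTensor_iff]
  intro p x₀
  have hu := uniqueDiffOn_extChartAt_target (I := I) x₀
  have h1 := SmoothTendsto.const hu (continuous_fst.tendsto p)
  have h2 := continuous_symTensor_iff.1 continuous_snd p x₀
  have h := SmoothTendsto.bilin (ContinuousLinearMap.lsmul ℝ ℝ) hu
    (fun q => contDiffOn_const) contDiffOn_const
    (fun q : ℝ × SymTensor I M => contDiffOn_symRep q.2 x₀) (contDiffOn_symRep p.2 x₀) h1 h2
  exact h.congr (fun q : ℝ × SymTensor I M => symRep_smul q.1 q.2 x₀) (symRep_smul _ _ x₀)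

theorem contMDiff_symBil (α β : OneForm I M n) :
    ContMDiff I (I.prod 𝓘(ℝ, 𝔼 m →L[ℝ] 𝔼 m →L[ℝ] ℝ)) ∞
      (fun x => TotalSpace.mk' (𝔼 m →L[ℝ] 𝔼 m →L[ℝ] ℝ)
      (E := fun x : M => TangentSpace I x →L[ℝ] TangentSpace I x →L[ℝ] ℝ) x
        (symBil (formVal (α x)) (formVal (β x)))) :=
  contMDiff_tensor_iff.2 fun x₀ =>
    (contMDiffOn_bilin symBil (contMDiffOn_oneForm α x₀) (contMDiffOn_oneForm β x₀)).congr
      fun _ _ => symBil_comp _ _ _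

/-- The symmetric tensor field `αᵀβ + βᵀα`. -/
def symProductField (α β : OneForm I M n) : SymTensor I M :=
  ⟨⟨fun x => symBil (formVal (α x)) (formVal (β x)), contMDiff_symBil α β⟩, fun x v w =>
    symBil_symm (formVal (α x)) (formVal (β x)) v w⟩

theorem symTensor_ext {h k : SymTensor I M} (e : ∀ x, tensorVal (h.1 x) = tensorVal (k.1 x)) :
    h = k :=
  Subtype.ext (ContMDiffSection.ext e)

theorem oneForm_ext {α β : OneForm I M n} (e : ∀ x, formVal (α x) = formVal (β x)) : α = β :=
  ContMDiffSection.ext e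

/-- The symmetric tensor field `αᵀβ + βᵀα`, as a bilinear map. -/
def symProduct : OneForm I M n →ₗ[ℝ] OneForm I M n →ₗ[ℝ] SymTensor I M :=
  LinearMap.mk₂ ℝ symProductField
    (fun α α' β => symTensor_ext fun x => symBil.map_add₂ (formVal (α x)) (formVal (α' x))
      (formVal (β x)))
    (fun c α β => symTensor_ext fun x => symBil.map_smul₂ c (formVal (α x)) (formVal (β x)))
    (fun α β β' => symTensor_ext fun x => (symBil (formVal (α x))).map_add
      (formVal (β x)) (formVal (β' x)))
    (fun c α β => symTensor_ext fun x => (symBil (formVal (α x))).map_smul c (formVal (β x)))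

theorem symProduct_comm (α β : OneForm I M n) : symProduct α β = symProduct β α :=
  symTensor_ext fun _ => symBil_comm _ _

theorem half_smul_symBil (a : 𝔼 m →L[ℝ] 𝔼 n) : gramForm a = (1 / 2 : ℝ) • symBil a a := by
  ext v w
  rw [_root_.smul_apply, _root_.smul_apply, symBil_apply, gramForm_apply, smul_eq_mul]
  ring

/-- Polarizing by `½ (αᵀβ + βᵀα)` rather than by `αᵀβ` keeps the values symmetric, so the general
results on quadratic maps apply with target `SymTensor I M`. -/
theorem pullbackMetric_eq : (pullbackMetric : OneForm I M n → SymTensor I M) =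
    fun α => ((1 / 2 : ℝ) • symProduct (I := I) (M := M) (n := n)) α α :=
  funext fun _ => symTensor_ext fun _ => half_smul_symBil _

theorem symRep_symProduct (α β : OneForm I M n) (x₀ : M) :
    EqOn (symRep (symProduct α β) x₀)
      (fun y => symBil (formRep α x₀ y) (formRep β x₀ y))
      (extChartAt I x₀).target := by
  intro y hy
  simp only [symRep_apply _ _ hy, formRep_apply]
  exact symBil_comp _ _ _

theorem continuous_symProduct :
    Continuous fun p : OneForm I M n × OneForm I M n => symProduct p.1 p.2 := by
  refine continuous_symTensor_iff.2 fun p x₀ => ?_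
  have h1 := continuous_oneForm_iff.1 continuous_fst p x₀
  have h2 := continuous_oneForm_iff.1 continuous_snd p x₀
  have h := SmoothTendsto.bilin symBil (uniqueDiffOn_extChartAt_target x₀)
    (fun q : OneForm I M n × OneForm I M n => contDiffOn_formRep q.1 x₀) (contDiffOn_formRep p.1 x₀)
    (fun q : OneForm I M n × OneForm I M n => contDiffOn_formRep q.2 x₀) (contDiffOn_formRep p.2 x₀) h1 h2
  exact h.congr (fun q : OneForm I M n × OneForm I M n => symRep_symProduct q.1 q.2 x₀) (symRep_symProduct _ _ x₀)

theorem isFrechetSmooth_pullbackMetric (U : Set (OneForm I M n)) :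
    IsFrechetSmooth pullbackMetric U := by
  rw [pullbackMetric_eq]
  refine isFrechetSmooth_quadratic _ ?_ U
  exact (continuous_const (y := (1 / 2 : ℝ))).smul continuous_symProduct

/-- The differential `ζ ↦ αᵀζ + ζᵀα` of `α ↦ αᵀα`. -/
def pullbackDeriv (α : OneForm I M n) : OneForm I M n →L[ℝ] SymTensor I M where
  toLinearMap := symProduct α
  cont := continuous_symProduct.comp (continuous_const.prodMk continuous_id)

theorem pullbackDeriv_apply (α ζ : OneForm I M n) : pullbackDeriv α ζ = symProduct α ζ := rfl

theorem hasGateauxDerivAt_pullbackMetric (α : OneForm I M n) :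
    HasGateauxDerivAt pullbackMetric (pullbackDeriv α) α := by
  rw [pullbackMetric_eq]
  convert hasGateauxDerivAt_quadratic ((1 / 2 : ℝ) • symProduct (I := I) (M := M) (n := n)) α using 1
  funext ζ
  rw [pullbackDeriv_apply, LinearMap.smul_apply, LinearMap.smul_apply, LinearMap.smul_apply,
    LinearMap.smul_apply, symProduct_comm ζ α, ← add_smul]
  norm_num

theorem injective_formVal {α : OneForm I M n} (hα : α ∈ fullRankForms I M n) (x : M) :
    Function.Injective (formVal (α x)) := hα x

theorem injective_formVal_comp {α : OneForm I M n} (hα : α ∈ fullRankForms I M n) {x₀ x : M}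
    (hx : x ∈ (chartAt H x₀).source) :
    Function.Injective ((formVal (α x)).comp (coordFrame I x₀ x)) :=
  (injective_formVal hα x).comp (bijective_coordFrame hx).1

theorem contMDiffOn_pinv {α : OneForm I M n} (hα : α ∈ fullRankForms I M n) (x₀ : M) :
    ContMDiffOn I 𝓘(ℝ, 𝔼 n →L[ℝ] 𝔼 m) ∞
      (fun x => pinv ((formVal (α x)).comp (coordFrame I x₀ x))) (chartAt H x₀).source :=
  fun x hx => (contDiffAt_pinv (injective_formVal_comp hα hx)).contMDiffAt.comp_contMDiffWithinAt x
    (contMDiffOn_oneForm α x₀ x hx)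

theorem contMDiffOn_liftBil {α : OneForm I M n} (hα : α ∈ fullRankForms I M n)
    (k : Tensor02 I M) (x₀ : M) :
    ContMDiffOn I 𝓘(ℝ, 𝔼 m →L[ℝ] 𝔼 n) ∞
      (fun x => liftBil (pinv ((formVal (α x)).comp (coordFrame I x₀ x)))
        (pullForm (coordFrame I x₀ x) (tensorVal (k x)))) (chartAt H x₀).source :=
  contMDiffOn_bilin liftBil (contMDiffOn_pinv hα x₀) (contMDiffOn_tensor k x₀)

theorem contMDiff_lift {α : OneForm I M n} (hα : α ∈ fullRankForms I M n)
    (k : Tensor02 I M) :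
    ContMDiff I (I.prod 𝓘(ℝ, 𝔼 m →L[ℝ] 𝔼 n)) ∞ (fun x => TotalSpace.mk' (𝔼 m →L[ℝ] 𝔼 n)
      (E := fun x : M => TangentSpace I x →L[ℝ] 𝔼 n) x
        (liftBil (pinv (formVal (α x))) (tensorVal (k x)))) :=
  contMDiff_oneForm_iff.2 fun x₀ => (contMDiffOn_liftBil hα k x₀).congr fun x hx =>
    liftBil_comp (injective_formVal hα x) (bijective_coordFrame hx) _

/-- The horizontal lift `k ↦ ½ α (αᵀα)⁻¹ k`, as a linear map. -/
def horizontalLiftₗ {α : OneForm I M n} (hα : α ∈ fullRankForms I M n) :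
    SymTensor I M →ₗ[ℝ] OneForm I M n where
  toFun k := ⟨fun x => liftBil (pinv (formVal (α x))) (tensorVal (k.1 x)), contMDiff_lift hα k.1⟩
  map_add' h k := oneForm_ext fun x =>
    (liftBil (pinv (formVal (α x)))).map_add (tensorVal (h.1 x)) (tensorVal (k.1 x))
  map_smul' c k := oneForm_ext fun x =>
    (liftBil (pinv (formVal (α x)))).map_smul c (tensorVal (k.1 x))

theorem formRep_lift {α : OneForm I M n} (hα : α ∈ fullRankForms I M n)
    (k : SymTensor I M) (x₀ : M) :
    EqOn (formRep (horizontalLiftₗ hα k) x₀)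
      (fun y => liftBil (pinv (formRep α x₀ y)) (symRep k x₀ y))
      (extChartAt I x₀).target := by
  intro y hy
  simp only [symRep_apply _ _ hy, formRep_apply]
  exact liftBil_comp (injective_formVal hα _) (bijective_coordFrame (symm_mem_chart_source hy)) _

theorem contDiffOn_pinv_formRep {α : OneForm I M n} (hα : α ∈ fullRankForms I M n) (x₀ : M) :
    ContDiffOn ℝ ∞ (fun y => pinv (formRep α x₀ y)) (extChartAt I x₀).target := by
  intro y hy
  have h : ContDiffAt ℝ ∞ pinv (formRep α x₀ y) := by
    rw [formRep_apply]
    exact contDiffAt_pinv (injective_formVal_comp hα (symm_mem_chart_source hy))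
  exact h.comp_contDiffWithinAt y (contDiffOn_formRep α x₀ y hy)

/-- With `α` fixed, the factor `pinv α` is a constant family, so only the tensor varies in the
bilinear expression. -/
theorem continuous_horizontalLift {α : OneForm I M n} (hα : α ∈ fullRankForms I M n) :
    Continuous (horizontalLiftₗ hα) := by
  refine continuous_oneForm_iff.2 fun k x₀ => ?_
  have h2 := continuous_symTensor_iff.1 continuous_id k x₀
  have h := SmoothTendsto.bilin liftBil (uniqueDiffOn_extChartAt_target x₀)
    (fun _ => contDiffOn_pinv_formRep hα x₀) (contDiffOn_pinv_formRep hα x₀)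
    (fun q => contDiffOn_symRep q x₀) (contDiffOn_symRep k x₀)
    (SmoothTendsto.refl _) h2
  exact h.congr (fun q => formRep_lift hα q x₀) (formRep_lift hα _ x₀)

/-- The horizontal lift `k ↦ ½ α (αᵀα)⁻¹ k`. -/
def horizontalLift {α : OneForm I M n} (hα : α ∈ fullRankForms I M n) :
    SymTensor I M →L[ℝ] OneForm I M n where
  toLinearMap := horizontalLiftₗ hα
  cont := continuous_horizontalLift hα

theorem pullbackDeriv_horizontalLift {α : OneForm I M n} (hα : α ∈ fullRankForms I M n)
    (k : SymTensor I M) : pullbackDeriv α (horizontalLift hα k) = k :=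
  symTensor_ext fun x =>
    symBil_liftBil (injective_formVal hα x) (k := tensorVal (k.1 x)) (k.2 x)

end Submersion

/-! ### Surjectivity of `α ↦ αᵀα` -/

section Surjectivity

variable {m n : ℕ} {H : Type*} [TopologicalSpace H] {I : ModelWithCorners ℝ (𝔼 m) H}
  {M : Type*} [TopologicalSpace M] [ChartedSpace H M] [IsManifold I ∞ M]

theorem gramForm_posDef {a : 𝔼 m →L[ℝ] 𝔼 n} (ha : Function.Injective a) (v : 𝔼 m) (hv : v ≠ 0) :
    0 < gramForm a v v := by
  rw [gramForm_apply, real_inner_self_pos]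
  exact fun h => hv (ha (h.trans (map_zero a).symm))

theorem pullbackMetric_val (α : OneForm I M n) (x : M) :
    tensorVal ((pullbackMetric α).1 x) = gramForm (formVal (α x)) := rfl

theorem mapsTo_pullbackMetric :
    MapsTo pullbackMetric (fullRankForms I M n) (riemannianMetrics I M) :=
  fun _ hα x v hv => gramForm_posDef (injective_formVal hα x) v hv

theorem contMDiff_transition {β : OneForm I M n} (hβ : β ∈ fullRankForms I M n)
    {g : SymTensor I M} (hg : g ∈ riemannianMetrics I M) :
    ContMDiff I (I.prod 𝓘(ℝ, 𝔼 m →L[ℝ] 𝔼 n)) ∞ (fun x => TotalSpace.mk' (𝔼 m →L[ℝ] 𝔼 n)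
      (E := fun x : M => TangentSpace I x →L[ℝ] 𝔼 n) x
        ((posSqrt (transitionOp (formVal (β x)) (tensorVal (g.1 x)))).comp (formVal (β x)))) := by
  refine contMDiff_oneForm_iff.2 fun x₀ => ?_
  have ha := contMDiffOn_oneForm β x₀
  have hb := contMDiffOn_pinv hβ x₀
  have hT : ContMDiffOn I 𝓘(ℝ, 𝔼 n →L[ℝ] 𝔼 n) ∞
      (fun x => transitionOp (formVal (β x)) (tensorVal (g.1 x))) (chartAt H x₀).source := by
    have h2 : ContMDiffOn I 𝓘(ℝ, ℝ) ∞ (fun _ : M => (2 : ℝ)) (chartAt H x₀).source :=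
      contMDiffOn_const
    have hid : ContMDiffOn I 𝓘(ℝ, 𝔼 n →L[ℝ] 𝔼 n) ∞
        (fun _ : M => ContinuousLinearMap.id ℝ (𝔼 n)) (chartAt H x₀).source :=
      contMDiffOn_const
    have h := ((h2.smul ((contMDiffOn_liftBil hβ g.1 x₀).clm_comp hb)).add hid).sub
      (ha.clm_comp hb)
    -- The smooth expression is the transition operator computed in the frame at `x₀`; frame
    -- invariance identifies it with the intrinsic one.
    refine h.congr fun x hx => ?_
    rw [← transitionOp_comp (injective_formVal hβ x) (bijective_coordFrame (I := I) hx),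
      transitionOp_def]
    rfl
  have hS : ContMDiffOn 𝓘(ℝ, 𝔼 n →L[ℝ] 𝔼 n) 𝓘(ℝ, 𝔼 n →L[ℝ] 𝔼 n) ∞ posSqrt
      (posDefOperators n) :=
    (show ContDiffOn ℝ ∞ posSqrt (posDefOperators n) from
      fun Q hQ => contDiffWithinAt_posSqrt hQ).contMDiffOn
  exact (hS.comp hT fun x _ => transitionOp_mem (injective_formVal hβ x)
    (k := tensorVal (g.1 x)) (g.2 x) (hg x)).clm_comp ha

theorem injective_of_mem_posDefOperators {S : 𝔼 n →L[ℝ] 𝔼 n} (hS : S ∈ posDefOperators n) :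
    Function.Injective S := by
  refine (injective_iff_map_eq_zero _).2 fun v hv => ?_
  by_contra h0
  have := hS.2 v h0
  rw [hv, inner_zero_left] at this
  exact lt_irrefl _ this

theorem surjOn_pullbackMetric (hne : (fullRankForms I M n).Nonempty) :
    SurjOn pullbackMetric (fullRankForms I M n) (riemannianMetrics I M) := by
  intro g hg
  obtain ⟨β, hβ⟩ := hne
  have h : ∀ x : M, gramForm ((posSqrt (transitionOp (formVal (β x)) (tensorVal (g.1 x)))).comp
      (formVal (β x))) = tensorVal (g.1 x) := fun x =>
    gramForm_posSqrt_transitionOp (injective_formVal hβ x) (g.2 x) (hg x)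
  refine ⟨⟨fun x => (posSqrt (transitionOp (formVal (β x)) (tensorVal (g.1 x)))).comp
    (formVal (β x)), contMDiff_transition hβ hg⟩, fun x => ?_, symTensor_ext h⟩
  have hQ := posSqrt_spec (transitionOp_mem (injective_formVal hβ x) (k := tensorVal (g.1 x))
    (g.2 x) (hg x))
  exact (injective_of_mem_posDefOperators hQ.1).comp (injective_formVal hβ x)

end Surjectivity

/-! ### Openness -/

section Openness

/-- The compact image `f(K)` has an `ε`-thickening inside `U`. -/
theorem eventually_mapsTo_of_tendstoUniformlyOn {ι X Z : Type*} [TopologicalSpace X]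
    [PseudoMetricSpace Z] {l : Filter ι} {F : ι → X → Z} {f : X → Z} {K : Set X}
    (h : TendstoUniformlyOn F f l K) (hf : ContinuousOn f K) (hK : IsCompact K) {U : Set Z}
    (hU : IsOpen U) (hfU : MapsTo f K U) : ∀ᶠ i in l, MapsTo (F i) K U := by
  obtain ⟨ε, hε, hsub⟩ := (hK.image_of_continuousOn hf).exists_thickening_subset_open hU
    hfU.image_subset
  filter_upwards [Metric.tendstoUniformlyOn_iff.1 h ε hε] with i hi x hx
  refine hsub (Metric.mem_thickening_iff.2 ⟨f x, mem_image_of_mem f hx, ?_⟩)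
  rw [dist_comm]
  exact hi x hx

/-- Finitely many compact neighbourhoods, each inside one chart domain, cover `M`, and finitely many
eventual conditions hold simultaneously. -/
theorem eventually_forall_of_forall_chart {E : Type*} [NormedAddCommGroup E] [NormedSpace ℝ E]
    [FiniteDimensional ℝ E] {H : Type*} [TopologicalSpace H] (I : ModelWithCorners ℝ E H)
    {M : Type*} [TopologicalSpace M] [ChartedSpace H M] [CompactSpace M]
    {ι : Type*} {l : Filter ι} {p : ι → M → Prop}
    (h : ∀ x₀ : M, ∀ K ⊆ (extChartAt I x₀).target, IsCompact K →
      ∀ᶠ i in l, ∀ y ∈ K, p i ((extChartAt I x₀).symm y)) :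
    ∀ᶠ i in l, ∀ x, p i x := by
  have : LocallyCompactSpace H := I.locallyCompactSpace
  have : LocallyCompactSpace M := ChartedSpace.locallyCompactSpace H M
  have hN : ∀ x₀ : M, ∃ C ∈ 𝓝 x₀, ∀ᶠ i in l, ∀ x ∈ C, p i x := by
    intro x₀
    obtain ⟨C, hC, hCs, hCc⟩ := local_compact_nhds (extChartAt_source_mem_nhds (I := I) x₀)
    refine ⟨C, hC, ?_⟩
    have := h x₀ (extChartAt I x₀ '' C)
      (image_subset_iff.2 fun x hx => (extChartAt I x₀).map_source (hCs hx))
      (hCc.image_of_continuousOn ((continuousOn_extChartAt x₀).mono hCs))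
    filter_upwards [this] with i hi x hx
    have := hi _ (mem_image_of_mem _ hx)
    rwa [(extChartAt I x₀).left_inv (hCs hx)] at this
  choose C hC hp using hN
  obtain ⟨t, ht⟩ := CompactSpace.elim_nhds_subcover C hC
  have h2 : ∀ᶠ i in l, ∀ x₀ ∈ t, ∀ x ∈ C x₀, p i x := t.eventually_all.2 fun x₀ _ => hp x₀
  filter_upwards [h2] with i hi x
  have hx : x ∈ ⋃ x₀ ∈ t, C x₀ := by
    rw [ht]
    exact mem_univ x
  obtain ⟨x₀, hx₀, hx⟩ := mem_iUnion₂.1 hx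
  exact hi x₀ hx₀ x hx

variable {m n : ℕ} {H : Type*} [TopologicalSpace H] {I : ModelWithCorners ℝ (𝔼 m) H}
  {M : Type*} [TopologicalSpace M] [ChartedSpace H M] [IsManifold I ∞ M] [CompactSpace M]

theorem isOpen_fullRankForms : IsOpen (fullRankForms I M n) := by
  refine isOpen_iff_eventually.2 fun α hα => ?_
  refine eventually_forall_of_forall_chart I
    (p := fun (β : OneForm I M n) x => Function.Injective (formVal (β x))) fun x₀ K hK hKc => ?_
  have h := (continuous_oneForm_iff.1 continuous_id α x₀).tendstoUniformlyOn hK hKc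
  have hc := (contDiffOn_formRep α x₀).continuousOn.mono hK
  have h2 := eventually_mapsTo_of_tendstoUniformlyOn h hc hKc isOpen_injective fun y hy => by
    rw [id, formRep_apply]
    exact injective_formVal_comp hα (symm_mem_chart_source (hK hy))
  filter_upwards [h2] with β hβ y hy
  have h3 : Function.Injective (formRep β x₀ y) := hβ hy
  rw [formRep_apply] at h3
  exact Function.Injective.of_comp_right h3
    (bijective_coordFrame (symm_mem_chart_source (hK hy))).2

theorem isOpen_riemannianMetrics : IsOpen (riemannianMetrics I M) := by
  refine isOpen_iff_eventually.2 fun g hg => ?_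
  refine eventually_forall_of_forall_chart I
    (p := fun (k : SymTensor I M) x => ∀ v : 𝔼 m, v ≠ 0 → 0 < tensorVal (k.1 x) v v)
    fun x₀ K hK hKc => ?_
  have h := (continuous_symTensor_iff.1 continuous_id g x₀).tendstoUniformlyOn hK hKc
  have hc := (contDiffOn_symRep g x₀).continuousOn.mono hK
  have h2 := eventually_mapsTo_of_tendstoUniformlyOn h hc hKc isOpen_posDef fun y hy => by
    rw [id, symRep_apply _ _ (hK hy)]
    exact (posDef_pullForm_iff (bijective_coordFrame (symm_mem_chart_source (hK hy))) _).2
      (hg ((extChartAt I x₀).symm y))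
  filter_upwards [h2] with k hk y hy
  have h3 : ∀ v : 𝔼 m, v ≠ 0 → 0 < symRep k x₀ y v v := hk hy
  rw [symRep_apply _ _ (hK hy)] at h3
  exact (posDef_pullForm_iff (bijective_coordFrame (symm_mem_chart_source (hK hy))) _).1 h3

end Openness

/-! ### Matrices and traces -/

section Matrices

variable {l m n : ℕ}

/-- The matrix of a linear map with respect to the standard bases. -/
def formMat (a : 𝔼 m →L[ℝ] 𝔼 n) : Matrix (Fin n) (Fin m) ℝ :=
  Matrix.of fun i j => a (EuclideanSpace.single j 1) i

/-- The matrix of a bilinear form with respect to the standard basis. -/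
def tensorMat (k : 𝔼 m →L[ℝ] 𝔼 m →L[ℝ] ℝ) : Matrix (Fin m) (Fin m) ℝ :=
  Matrix.of fun i j => k (EuclideanSpace.single i 1) (EuclideanSpace.single j 1)

theorem formMat_apply (a : 𝔼 m →L[ℝ] 𝔼 n) (i : Fin n) (j : Fin m) :
    formMat a i j = a (EuclideanSpace.single j 1) i := rfl

theorem tensorMat_apply (k : 𝔼 m →L[ℝ] 𝔼 m →L[ℝ] ℝ) (i j : Fin m) :
    tensorMat k i j = k (EuclideanSpace.single i 1) (EuclideanSpace.single j 1) := rfl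

theorem euclidean_eq_sum (v : 𝔼 m) : v = ∑ j, v j • (EuclideanSpace.single j (1 : ℝ) : 𝔼 m) := by
  conv_lhs => rw [← (EuclideanSpace.basisFun (Fin m) ℝ).sum_repr v]
  simp

theorem inner_eq_sum_mul (v w : 𝔼 m) : inner ℝ v w = ∑ i, v i * w i := by
  rw [PiLp.inner_apply]
  exact Finset.sum_congr rfl fun i _ => mul_comm _ _

theorem formMat_comp (a : 𝔼 m →L[ℝ] 𝔼 n) (b : 𝔼 l →L[ℝ] 𝔼 m) :
    formMat (a.comp b) = formMat a * formMat b := by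
  ext i j
  rw [Matrix.mul_apply, formMat_apply, ContinuousLinearMap.comp_apply]
  conv_lhs => rw [euclidean_eq_sum (b (EuclideanSpace.single j 1)), map_sum]
  simp [formMat_apply, mul_comm]

theorem formMat_id : formMat (ContinuousLinearMap.id ℝ (𝔼 m)) = 1 := by
  ext i j
  simp [formMat_apply, Matrix.one_apply]

theorem tensorMat_gramForm (a : 𝔼 m →L[ℝ] 𝔼 n) :
    tensorMat (gramForm a) = (formMat a)ᵀ * formMat a := by
  ext i j
  rw [Matrix.mul_apply, tensorMat_apply, gramForm_apply, inner_eq_sum_mul]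
  rfl

theorem tensorMat_symBil (a b : 𝔼 m →L[ℝ] 𝔼 n) :
    tensorMat (symBil a b) = (formMat a)ᵀ * formMat b + (formMat b)ᵀ * formMat a := by
  ext i j
  rw [Matrix.add_apply, Matrix.mul_apply, Matrix.mul_apply, tensorMat_apply, symBil_apply,
    inner_eq_sum_mul, inner_eq_sum_mul]
  rfl

theorem formMat_liftBil (b : 𝔼 n →L[ℝ] 𝔼 m) (k : 𝔼 m →L[ℝ] 𝔼 m →L[ℝ] ℝ) :
    formMat (liftBil b k) = (1 / 2 : ℝ) • (tensorMat k * formMat b)ᵀ := by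
  ext i j
  rw [Matrix.smul_apply, Matrix.transpose_apply, Matrix.mul_apply, formMat_apply]
  have h : liftBil b k (EuclideanSpace.single j 1) i =
      inner ℝ (liftBil b k (EuclideanSpace.single j 1)) (EuclideanSpace.single i (1 : ℝ)) := by
    rw [EuclideanSpace.inner_single_right, one_mul, conj_trivial]
  rw [h, inner_liftBil, euclidean_eq_sum (b (EuclideanSpace.single i 1)), map_sum, smul_eq_mul]
  simp [formMat_apply, tensorMat_apply, mul_comm]

theorem formMat_pinv_mul {a : 𝔼 m →L[ℝ] 𝔼 n} (ha : Function.Injective a) :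
    formMat (pinv a) * formMat a = 1 := by
  rw [← formMat_comp, ← formMat_id]
  congr 1
  exact ContinuousLinearMap.ext fun v => pinv_apply_self ha v

theorem gram_mul_formMat_pinv {a : 𝔼 m →L[ℝ] 𝔼 n} (ha : Function.Injective a) :
    (formMat a)ᵀ * formMat a * formMat (pinv a) = (formMat a)ᵀ := by
  rw [Matrix.mul_assoc, ← formMat_comp]
  ext i j
  have h := inner_pinv ha (EuclideanSpace.single j 1) (EuclideanSpace.single i 1)
  rw [real_inner_comm, inner_eq_sum_mul] at h
  rw [Matrix.mul_apply, Matrix.transpose_apply, formMat_apply a]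
  refine h.trans ?_
  rw [EuclideanSpace.inner_single_left, conj_trivial, one_mul]

/-- With `B` the matrix of `pinv a`, the normal equations give `AᵀA B Bᵀ = AᵀBᵀ = (BA)ᵀ = 1`. -/
theorem inv_gram {a : 𝔼 m →L[ℝ] 𝔼 n} (ha : Function.Injective a) :
    ((formMat a)ᵀ * formMat a)⁻¹ = formMat (pinv a) * (formMat (pinv a))ᵀ := by
  refine Matrix.inv_eq_right_inv ?_
  rw [← Matrix.mul_assoc, gram_mul_formMat_pinv ha, ← Matrix.transpose_mul, formMat_pinv_mul ha,
    Matrix.transpose_one]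

theorem det_gram_pos {a : 𝔼 m →L[ℝ] 𝔼 n} (ha : Function.Injective a) :
    0 < ((formMat a)ᵀ * formMat a).det := by
  refine lt_of_le_of_ne (Matrix.posSemidef_conjTranspose_mul_self (formMat a)).det_nonneg
    (Ne.symm fun h0 => ?_)
  have h : (formMat a)ᵀ * formMat a * (formMat (pinv a) * (formMat (pinv a))ᵀ) = 1 := by
    rw [← Matrix.mul_assoc, gram_mul_formMat_pinv ha, ← Matrix.transpose_mul, formMat_pinv_mul ha,
      Matrix.transpose_one]
  have h2 := congrArg Matrix.det h
  rw [Matrix.det_mul, h0, zero_mul, Matrix.det_one] at h2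
  exact zero_ne_one h2

/-- The Hilbert–Schmidt inner product. -/
def hsInner (s t : 𝔼 n →L[ℝ] 𝔼 n) : ℝ :=
  ∑ i, inner ℝ (s (EuclideanSpace.single i 1)) (t (EuclideanSpace.single i 1))

theorem hsInner_eq_trace (s t : 𝔼 n →L[ℝ] 𝔼 n) :
    hsInner s t = (formMat s * (formMat t)ᵀ).trace := by
  rw [Matrix.trace_mul_comm, hsInner, Matrix.trace]
  refine Finset.sum_congr rfl fun i _ => ?_
  rw [inner_eq_sum_mul, Matrix.diag_apply, Matrix.mul_apply]
  exact Finset.sum_congr rfl fun j _ => mul_comm _ _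

theorem continuous_hsInner :
    Continuous fun p : (𝔼 n →L[ℝ] 𝔼 n) × (𝔼 n →L[ℝ] 𝔼 n) => hsInner p.1 p.2 := by
  unfold hsInner
  fun_prop

theorem hsInner_self_nonneg (s : 𝔼 n →L[ℝ] 𝔼 n) : 0 ≤ hsInner s s :=
  Finset.sum_nonneg fun _ _ => real_inner_self_nonneg

theorem eq_zero_of_hsInner_self {s : 𝔼 n →L[ℝ] 𝔼 n} (h : hsInner s s = 0) : s = 0 := by
  have h2 := (Finset.sum_eq_zero_iff_of_nonneg fun _ _ => real_inner_self_nonneg).1 h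
  refine ContinuousLinearMap.ext fun v => ?_
  rw [euclidean_eq_sum v, map_sum]
  refine Finset.sum_eq_zero fun i _ => ?_
  rw [map_smul, inner_self_eq_zero.1 (h2 i (Finset.mem_univ i)), smul_zero]

/-- The integrand of the generalized Ebin metric. -/
def ebinIntegrand (a ζ η : 𝔼 m →L[ℝ] 𝔼 n) : ℝ :=
  hsInner (ζ.comp (pinv a)) (η.comp (pinv a))

theorem trace_eq_ebinIntegrand {a : 𝔼 m →L[ℝ] 𝔼 n} (ha : Function.Injective a)
    (ζ η : 𝔼 m →L[ℝ] 𝔼 n) :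
    (formMat ζ * ((formMat a)ᵀ * formMat a)⁻¹ * (formMat η)ᵀ).trace = ebinIntegrand a ζ η := by
  rw [ebinIntegrand, hsInner_eq_trace, inv_gram ha, formMat_comp, formMat_comp,
    Matrix.transpose_mul]
  simp only [Matrix.mul_assoc]

theorem ebinIntegrand_comm (a ζ η : 𝔼 m →L[ℝ] 𝔼 n) :
    ebinIntegrand a ζ η = ebinIntegrand a η ζ := by
  unfold ebinIntegrand hsInner
  exact Finset.sum_congr rfl fun _ _ => real_inner_comm _ _

theorem ebinIntegrand_add_left (a ζ ζ' η : 𝔼 m →L[ℝ] 𝔼 n) :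
    ebinIntegrand a (ζ + ζ') η = ebinIntegrand a ζ η + ebinIntegrand a ζ' η := by
  unfold ebinIntegrand hsInner
  rw [← Finset.sum_add_distrib]
  exact Finset.sum_congr rfl fun _ _ => inner_add_left _ _ _

theorem ebinIntegrand_smul_left (c : ℝ) (a ζ η : 𝔼 m →L[ℝ] 𝔼 n) :
    ebinIntegrand a (c • ζ) η = c * ebinIntegrand a ζ η := by
  unfold ebinIntegrand hsInner
  rw [Finset.mul_sum]
  exact Finset.sum_congr rfl fun _ _ => real_inner_smul_left _ _ _

theorem ebinIntegrand_self_nonneg (a ζ : 𝔼 m →L[ℝ] 𝔼 n) : 0 ≤ ebinIntegrand a ζ ζ :=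
  hsInner_self_nonneg _

/-- Vanishing of `ζ b` suffices, because `ζ = ζ b a`. -/
theorem eq_zero_of_ebinIntegrand_self {a : 𝔼 m →L[ℝ] 𝔼 n} (ha : Function.Injective a)
    {ζ : 𝔼 m →L[ℝ] 𝔼 n} (h : ebinIntegrand a ζ ζ = 0) : ζ = 0 := by
  refine ContinuousLinearMap.ext fun v => ?_
  have h2 := DFunLike.congr_fun (eq_zero_of_hsInner_self h) (a v)
  rw [ContinuousLinearMap.comp_apply, pinv_apply_self ha] at h2
  exact h2

/-- With `S = (AᵀA)⁻¹` the lift has matrix `½ A S K`, and the pairing becomes `½ tr (S K S · WᵀA)`.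
Here `S K S` is symmetric, while `WᵀA` is antisymmetric because `w` is vertical. -/
theorem ebinIntegrand_liftBil_vertical {a : 𝔼 m →L[ℝ] 𝔼 n} (ha : Function.Injective a)
    {k : 𝔼 m →L[ℝ] 𝔼 m →L[ℝ] ℝ} (hk : ∀ v w, k v w = k w v) {w : 𝔼 m →L[ℝ] 𝔼 n}
    (hw : symBil a w = 0) : ebinIntegrand a (liftBil (pinv a) k) w = 0 := by
  have hK : (tensorMat k)ᵀ = tensorMat k := by
    ext i j
    exact hk _ _
  have hW : (formMat a)ᵀ * formMat w = -((formMat w)ᵀ * formMat a) := by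
    rw [eq_neg_iff_add_eq_zero, ← tensorMat_symBil, hw]
    rfl
  have hB : (formMat (pinv a))ᵀ = formMat a * (formMat (pinv a) * (formMat (pinv a))ᵀ) := by
    have h1 : formMat (pinv a) = formMat (pinv a) * (formMat (pinv a))ᵀ * (formMat a)ᵀ := by
      rw [← gram_mul_formMat_pinv ha, ← inv_gram ha, ← Matrix.mul_assoc,
        Matrix.nonsing_inv_mul _ (det_gram_pos ha).ne'.isUnit, Matrix.one_mul]
    conv_lhs => rw [h1]
    simp [Matrix.transpose_mul, Matrix.mul_assoc]
  rw [← trace_eq_ebinIntegrand ha, formMat_liftBil, inv_gram ha, Matrix.transpose_mul, hK]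
  set S := formMat (pinv a) * (formMat (pinv a))ᵀ with hS
  have hSt : Sᵀ = S := by
    rw [hS, Matrix.transpose_mul, Matrix.transpose_transpose]
  set K := tensorMat k
  set W := formMat w
  set A := formMat a
  have h1 : ((1 / 2 : ℝ) • (A * S * K) * S * Wᵀ).trace =
      1 / 2 * ((S * K * S) * (Wᵀ * A)).trace := by
    rw [Matrix.smul_mul, Matrix.smul_mul, Matrix.trace_smul, smul_eq_mul]
    congr 1
    rw [Matrix.mul_assoc A, Matrix.mul_assoc A, Matrix.mul_assoc A, Matrix.trace_mul_comm A]
    simp only [Matrix.mul_assoc]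
  have h2 : ((S * K * S) * (Wᵀ * A)).trace = -((S * K * S) * (Wᵀ * A)).trace := by
    conv_lhs => rw [← Matrix.trace_transpose, Matrix.transpose_mul, Matrix.transpose_mul,
      Matrix.transpose_transpose, hW, Matrix.neg_mul, Matrix.trace_neg, Matrix.trace_mul_comm]
    simp only [Matrix.transpose_mul, hSt, hK, Matrix.mul_assoc]
  rw [hB, h1]
  linarith

/-- The lifts are `½ BᵀH` and `½ BᵀK`; inserting `(AᵀA)⁻¹ = B Bᵀ` and permuting cyclically under the
trace gives the claim. -/
theorem quarter_trace_eq {a : 𝔼 m →L[ℝ] 𝔼 n} (ha : Function.Injective a)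
    {h k : 𝔼 m →L[ℝ] 𝔼 m →L[ℝ] ℝ} (hh : ∀ v w, h v w = h w v) :
    1 / 4 * (tensorMat h * (tensorMat (gramForm a))⁻¹ * tensorMat k *
      (tensorMat (gramForm a))⁻¹).trace =
    ebinIntegrand a (liftBil (pinv a) h) (liftBil (pinv a) k) := by
  have hH : (tensorMat h)ᵀ = tensorMat h := by
    ext i j
    exact hh _ _
  rw [← trace_eq_ebinIntegrand ha, formMat_liftBil, formMat_liftBil, tensorMat_gramForm,
    inv_gram ha, Matrix.transpose_smul, Matrix.transpose_transpose, Matrix.transpose_mul, hH]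
  simp only [Matrix.smul_mul, Matrix.mul_smul, Matrix.trace_smul, smul_eq_mul]
  rw [← mul_assoc]
  congr 1
  · norm_num
  · simp only [Matrix.mul_assoc]
    rw [Matrix.trace_mul_comm (formMat (pinv a))ᵀ]
    simp only [Matrix.mul_assoc]

theorem ebinIntegrand_comp {a : 𝔼 m →L[ℝ] 𝔼 n} (ha : Function.Injective a) {P : 𝔼 m →L[ℝ] 𝔼 m}
    (hP : Function.Bijective P) (ζ η : 𝔼 m →L[ℝ] 𝔼 n) :
    ebinIntegrand (a.comp P) (ζ.comp P) (η.comp P) = ebinIntegrand a ζ η := by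
  unfold ebinIntegrand hsInner
  simp only [ContinuousLinearMap.comp_apply, pinv_comp ha hP]

end Matrices

/-! ### Properties of the integral -/

section Integral

theorem measurableSet_extChartAt_target {E : Type*} [NormedAddCommGroup E] [NormedSpace ℝ E]
    [MeasurableSpace E] [BorelSpace E] {H : Type*} [TopologicalSpace H]
    (I : ModelWithCorners ℝ E H) {M : Type*} [TopologicalSpace M] [ChartedSpace H M] (x₀ : M) :
    MeasurableSet (extChartAt I x₀).target := by
  rw [extChartAt_target]
  exact ((chartAt H x₀).open_target.preimage I.continuous_symm).measurableSet.inter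
    I.isClosed_range.measurableSet

variable {m n : ℕ} {H : Type*} [TopologicalSpace H] {I : ModelWithCorners ℝ (𝔼 m) H}
  {M : Type*} [TopologicalSpace M] [ChartedSpace H M] [IsManifold I ∞ M]

theorem volumeDensity_eq (g : SymTensor I M) (x₀ x : M) :
    volumeDensity g x₀ x = √(tensorMat (pullForm (coordFrame I x₀ x) (tensorVal (g.1 x)))).det := by
  have h : (Matrix.of fun i j : Fin m =>
      (g.1 x (coordVec I x₀ x i) (coordVec I x₀ x j) : ℝ)) =
      tensorMat (pullForm (coordFrame I x₀ x) (tensorVal (g.1 x))) := by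
    ext i j
    rw [tensorMat_apply, pullForm_apply]
    rfl
  rw [volumeDensity, h]

theorem continuousOn_volumeDensity (g : SymTensor I M) (x₀ : M) :
    ContinuousOn (volumeDensity g x₀) (chartAt H x₀).source := by
  have h : Continuous fun k : 𝔼 m →L[ℝ] 𝔼 m →L[ℝ] ℝ => √(tensorMat k).det := by
    refine Real.continuous_sqrt.comp (Continuous.matrix_det ?_)
    refine continuous_matrix fun i j => ?_
    simp only [tensorMat_apply]
    fun_prop
  exact (h.comp_continuousOn (contMDiffOn_tensor g.1 x₀).continuousOn).congr
    fun x _ => volumeDensity_eq g x₀ x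

theorem volumeDensity_nonneg (g : SymTensor I M) (x₀ x : M) : 0 ≤ volumeDensity g x₀ x :=
  Real.sqrt_nonneg _

theorem pullForm_gramForm (a : 𝔼 m →L[ℝ] 𝔼 n) (P : 𝔼 m →L[ℝ] 𝔼 m) :
    pullForm P (gramForm a) = gramForm (a.comp P) := by
  ext v w
  rw [pullForm_apply]
  rfl

theorem volumeDensity_pos {α : OneForm I M n} (hα : α ∈ fullRankForms I M n) {x₀ x : M}
    (hx : x ∈ (chartAt H x₀).source) : 0 < volumeDensity (pullbackMetric α) x₀ x := by
  rw [volumeDensity_eq, pullbackMetric_val, pullForm_gramForm, tensorMat_gramForm]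
  exact Real.sqrt_pos.2 (det_gram_pos (injective_formVal_comp hα hx))

variable [T2Space M] [CompactSpace M]

variable (I) in
theorem tsupport_chartPartition_subset (x₀ : M) :
    tsupport (chartPartition I M x₀) ⊆ (chartAt H x₀).source :=
  (SmoothPartitionOfUnity.exists_isSubordinate_chartAt_source I M).choose_spec x₀

/-- The contribution of the chart at `x₀` to the integral of `f`. -/
def chartIntegrand (g : SymTensor I M) (f : M → ℝ) (x₀ : M) (y : 𝔼 m) : ℝ :=
  chartPartition I M x₀ ((extChartAt I x₀).symm y) * f ((extChartAt I x₀).symm y) *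
    volumeDensity g x₀ ((extChartAt I x₀).symm y)

theorem riemannianIntegral_eq (g : SymTensor I M) (f : M → ℝ) : riemannianIntegral g f =
    ∑ᶠ x₀ : M, ∫ y in (extChartAt I x₀).target, chartIntegrand g f x₀ y := rfl

theorem continuousOn_chartIntegrand (g : SymTensor I M) {f : M → ℝ} (hf : Continuous f) (x₀ : M) :
    ContinuousOn (chartIntegrand g f x₀) (extChartAt I x₀).target := by
  have hs : ContinuousOn (extChartAt I x₀).symm (extChartAt I x₀).target :=
    continuousOn_extChartAt_symm x₀
  have h1 : Continuous (chartPartition I M x₀) := (chartPartition I M x₀).contMDiff.continuous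
  exact ((h1.comp_continuousOn hs).mul (hf.comp_continuousOn hs)).mul
    ((continuousOn_volumeDensity g x₀).comp hs fun y hy => symm_mem_chart_source hy)

/-- The chart target need not be compact, but the partition function confines the integrand to a
compact subset of it, on which it is continuous. -/
theorem integrableOn_chartIntegrand (g : SymTensor I M) {f : M → ℝ} (hf : Continuous f) (x₀ : M) :
    IntegrableOn (chartIntegrand g f x₀) (extChartAt I x₀).target := by
  set K := extChartAt I x₀ '' tsupport (chartPartition I M x₀) with hK
  have hs : tsupport (chartPartition I M x₀) ⊆ (extChartAt I x₀).source := by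
    rw [extChartAt_source]
    exact tsupport_chartPartition_subset I x₀
  have hKt : K ⊆ (extChartAt I x₀).target :=
    image_subset_iff.2 fun x hx => (extChartAt I x₀).map_source (hs hx)
  have hKc : IsCompact K := (isClosed_tsupport _).isCompact.image_of_continuousOn
    ((continuousOn_extChartAt x₀).mono hs)
  have h1 : IntegrableOn (chartIntegrand g f x₀) K :=
    ((continuousOn_chartIntegrand g hf x₀).mono hKt).integrableOn_compact hKc
  refine h1.of_forall_sdiff_eq_zero (measurableSet_extChartAt_target I x₀) fun y hy => ?_
  have h2 : chartPartition I M x₀ ((extChartAt I x₀).symm y) = 0 := by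
    by_contra h0
    exact hy.2 ⟨_, subset_tsupport _ h0, (extChartAt I x₀).right_inv hy.1⟩
  rw [chartIntegrand, h2, zero_mul, zero_mul]

/-- A locally finite family on a compact space has finitely many nonzero members. Without this
`finsum` would default to 0 and additivity could fail. -/
theorem finite_support_chartIntegral (g : SymTensor I M) (f : M → ℝ) :
    (Function.support fun x₀ : M =>
      ∫ y in (extChartAt I x₀).target, chartIntegrand g f x₀ y).Finite := by
  refine (chartPartition I M).locallyFinite.finite_nonempty_of_compact.subset fun x₀ hx₀ => ?_
  by_contra h0
  refine hx₀ ?_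
  have h1 : ∀ x, chartPartition I M x₀ x = 0 := fun x => by
    by_contra hx
    exact h0 ⟨x, hx⟩
  simp [chartIntegrand, h1]

theorem riemannianIntegral_add (g : SymTensor I M) {f f' : M → ℝ} (hf : Continuous f)
    (hf' : Continuous f') :
    riemannianIntegral g (fun x => f x + f' x) = riemannianIntegral g f + riemannianIntegral g f' := by
  rw [riemannianIntegral_eq, riemannianIntegral_eq, riemannianIntegral_eq,
    ← finsum_add_distrib (finite_support_chartIntegral g f) (finite_support_chartIntegral g f')]
  refine finsum_congr fun x₀ => ?_
  rw [← integral_add (integrableOn_chartIntegrand g hf x₀) (integrableOn_chartIntegrand g hf' x₀)]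
  refine integral_congr_ae (Eventually.of_forall fun y => ?_)
  simp only [chartIntegrand]
  ring

theorem riemannianIntegral_mul (g : SymTensor I M) (c : ℝ) (f : M → ℝ) :
    riemannianIntegral g (fun x => c * f x) = c * riemannianIntegral g f := by
  rw [riemannianIntegral_eq, riemannianIntegral_eq, mul_finsum]
  refine finsum_congr fun x₀ => ?_
  rw [← integral_const_mul]
  refine integral_congr_ae (Eventually.of_forall fun y => ?_)
  simp only [chartIntegrand]
  ring

theorem riemannianIntegral_zero (g : SymTensor I M) :
    riemannianIntegral g (fun _ : M => 0) = 0 := by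
  rw [riemannianIntegral_eq]
  simp [chartIntegrand]

/-- Some partition function is positive at `x₁`; in its chart the integrand is nonnegative and
positive near the image of `x₁`. -/
theorem riemannianIntegral_pos {α : OneForm I M n} (hα : α ∈ fullRankForms I M n) {f : M → ℝ}
    (hf : Continuous f) (hf0 : ∀ x, 0 ≤ f x) {x₁ : M} (hx₁ : 0 < f x₁) :
    0 < riemannianIntegral (pullbackMetric α) f := by
  have hnn : ∀ x₀ y, 0 ≤ chartIntegrand (pullbackMetric α) f x₀ y := fun x₀ y =>
    mul_nonneg (mul_nonneg ((chartPartition I M).nonneg _ _) (hf0 _)) (volumeDensity_nonneg _ _ _)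
  rw [riemannianIntegral_eq]
  refine finsum_pos (fun x₀ => integral_nonneg (hnn x₀)) ?_ (finite_support_chartIntegral _ _)
  obtain ⟨x₀, hx₀⟩ := (chartPartition I M).exists_pos_of_mem (mem_univ x₁)
  refine ⟨x₀, ?_⟩
  rw [setIntegral_pos_iff_support_of_nonneg_ae (Eventually.of_forall (hnn x₀))
    (integrableOn_chartIntegrand _ hf x₀)]
  have hxs : x₁ ∈ (chartAt H x₀).source :=
    tsupport_chartPartition_subset I x₀ (subset_tsupport _ hx₀.ne')
  have hxe : x₁ ∈ (extChartAt I x₀).source := by rwa [extChartAt_source]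
  set y₁ := extChartAt I x₀ x₁ with hy₁
  have hyt : y₁ ∈ (extChartAt I x₀).target := (extChartAt I x₀).map_source hxe
  have hpos : 0 < chartIntegrand (pullbackMetric α) f x₀ y₁ := by
    rw [chartIntegrand, hy₁, (extChartAt I x₀).left_inv hxe]
    exact mul_pos (mul_pos hx₀ hx₁) (volumeDensity_pos hα hxs)
  have hN : ∀ᶠ y in 𝓝[range I] y₁, y ∈ Function.support (chartIntegrand (pullbackMetric α) f x₀) ∩
      (extChartAt I x₀).target := by
    have ht : (extChartAt I x₀).target ∈ 𝓝[range I] y₁ := extChartAt_target_mem_nhdsWithin' hxe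
    have h1 := (continuousOn_chartIntegrand (pullbackMetric α) hf x₀ y₁ hyt).eventually
      (lt_mem_nhds hpos)
    have hle : 𝓝[range I] y₁ ≤ 𝓝[(extChartAt I x₀).target] y₁ :=
      nhdsWithin_le_of_mem ht
    filter_upwards [hle h1, ht] with y hy hyt
    exact ⟨ne_of_gt hy, hyt⟩
  obtain ⟨O, hO, hyO, hsub⟩ := mem_nhdsWithin.1 hN
  -- If `x₁` is a boundary point, positivity holds only on a relative neighbourhood in `range I`.
  -- Interior points of `range I` accumulate at `y₁`, and one of them supplies an honest open set of
  -- positive measure.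
  have hcl : y₁ ∈ closure (interior (range I)) :=
    I.range_subset_closure_interior (extChartAt_target_subset_range x₀ hyt)
  obtain ⟨z, hzO, hz⟩ := mem_closure_iff.1 hcl O hO hyO
  refine MeasureTheory.Measure.measure_pos_of_mem_nhds volume (x := z) ?_
  filter_upwards [(hO.inter isOpen_interior).mem_nhds ⟨hzO, hz⟩] with y hy
  exact hsub ⟨hy.1, interior_subset hy.2⟩

end Integral

/-! ### The two metrics and the submersion -/

section Main

variable {m n : ℕ} {H : Type*} [TopologicalSpace H] {I : ModelWithCorners ℝ (𝔼 m) H}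
  {M : Type*} [TopologicalSpace M] [ChartedSpace H M] [IsManifold I ∞ M]

/-- By frame invariance the integrand may be evaluated in the chart frame, where every ingredient is
continuous. -/
theorem continuous_ebinIntegrand {α : OneForm I M n} (hα : α ∈ fullRankForms I M n)
    (ζ η : OneForm I M n) :
    Continuous fun x => ebinIntegrand (formVal (α x)) (formVal (ζ x)) (formVal (η x)) := by
  refine continuous_iff_continuousAt.2 fun x₀ => ?_
  have hp := (contMDiffOn_pinv hα x₀).continuousOn
  have h1 := (contMDiffOn_oneForm ζ x₀).continuousOn.clm_comp hp
  have h2 := (contMDiffOn_oneForm η x₀).continuousOn.clm_comp hp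
  have h := continuous_hsInner.comp_continuousOn (h1.prodMk h2)
  refine ContinuousOn.continuousAt (h.congr fun x hx => ?_)
    ((chartAt H x₀).open_source.mem_nhds (mem_chart_source H x₀))
  exact (ebinIntegrand_comp (injective_formVal hα x) (bijective_coordFrame hx) _ _).symm

theorem pullbackDeriv_sub_horizontalLift {α : OneForm I M n} (hα : α ∈ fullRankForms I M n)
    (v : OneForm I M n) :
    pullbackDeriv α (v - horizontalLift hα (pullbackDeriv α v)) = 0 := by
  have h := (pullbackDeriv α).toLinearMap.map_sub v (horizontalLift hα (pullbackDeriv α v))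
  refine h.trans (sub_eq_zero.2 ?_)
  exact (pullbackDeriv_horizontalLift hα _).symm

variable [T2Space M] [CompactSpace M]

theorem generalizedEbin_eq {α : OneForm I M n} (hα : α ∈ fullRankForms I M n)
    (ζ η : OneForm I M n) :
    generalizedEbin α ζ η = riemannianIntegral (pullbackMetric α)
      fun x => ebinIntegrand (formVal (α x)) (formVal (ζ x)) (formVal (η x)) := by
  unfold generalizedEbin
  congr 1
  funext x
  exact trace_eq_ebinIntegrand (injective_formVal hα x) (formVal (ζ x)) (formVal (η x))

theorem generalizedEbin_comm {α : OneForm I M n} (hα : α ∈ fullRankForms I M n)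
    (ζ η : OneForm I M n) : generalizedEbin α ζ η = generalizedEbin α η ζ := by
  rw [generalizedEbin_eq hα, generalizedEbin_eq hα]
  congr 1
  funext x
  exact ebinIntegrand_comm _ _ _

theorem generalizedEbin_add_left {α : OneForm I M n} (hα : α ∈ fullRankForms I M n)
    (ζ ζ' η : OneForm I M n) :
    generalizedEbin α (ζ + ζ') η = generalizedEbin α ζ η + generalizedEbin α ζ' η := by
  rw [generalizedEbin_eq hα, generalizedEbin_eq hα, generalizedEbin_eq hα,
    ← riemannianIntegral_add _ (continuous_ebinIntegrand hα ζ η)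
      (continuous_ebinIntegrand hα ζ' η)]
  congr 1
  funext x
  exact ebinIntegrand_add_left _ (formVal (ζ x)) (formVal (ζ' x)) _

theorem generalizedEbin_smul_left {α : OneForm I M n} (hα : α ∈ fullRankForms I M n)
    (c : ℝ) (ζ η : OneForm I M n) :
    generalizedEbin α (c • ζ) η = c * generalizedEbin α ζ η := by
  rw [generalizedEbin_eq hα, generalizedEbin_eq hα, ← riemannianIntegral_mul]
  congr 1
  funext x
  exact ebinIntegrand_smul_left c _ (formVal (ζ x)) _

theorem generalizedEbin_self_pos {α : OneForm I M n} (hα : α ∈ fullRankForms I M n)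
    {ζ : OneForm I M n} (hζ : ζ ≠ 0) : 0 < generalizedEbin α ζ ζ := by
  obtain ⟨x, hx⟩ : ∃ x, formVal (ζ x) ≠ 0 := by
    by_contra! h
    exact hζ (oneForm_ext h)
  rw [generalizedEbin_eq hα]
  refine riemannianIntegral_pos hα (continuous_ebinIntegrand hα ζ ζ)
    (fun x => ebinIntegrand_self_nonneg _ _) (x₁ := x) ?_
  exact lt_of_le_of_ne (ebinIntegrand_self_nonneg _ _)
    fun h => hx (eq_zero_of_ebinIntegrand_self (injective_formVal hα x) h.symm)

theorem isInnerProduct_generalizedEbin {α : OneForm I M n} (hα : α ∈ fullRankForms I M n) :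
    IsInnerProduct (generalizedEbin α) := by
  refine ⟨⟨LinearMap.mk₂ ℝ (generalizedEbin α) (generalizedEbin_add_left hα)
    (generalizedEbin_smul_left hα) (fun ζ η η' => ?_) (fun c ζ η => ?_), fun _ _ => rfl⟩,
    generalizedEbin_comm hα, fun _ => generalizedEbin_self_pos hα⟩
  · rw [generalizedEbin_comm hα, generalizedEbin_add_left hα, generalizedEbin_comm hα η,
      generalizedEbin_comm hα η']
  · rw [generalizedEbin_comm hα, generalizedEbin_smul_left hα, generalizedEbin_comm hα η]
    rfl

theorem quarter_ebin_eq {α : OneForm I M n} (hα : α ∈ fullRankForms I M n)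
    (h k : SymTensor I M) : (1 / 4 : ℝ) * ebin (pullbackMetric α) h k =
      generalizedEbin α (horizontalLift hα h) (horizontalLift hα k) := by
  rw [generalizedEbin_eq hα]
  unfold ebin
  rw [← riemannianIntegral_mul]
  congr 1
  funext x
  exact quarter_trace_eq (injective_formVal hα x) (h := tensorVal (h.1 x))
    (k := tensorVal (k.1 x)) (h.2 x)

theorem IsInnerProduct.comp {X Y : Type*} [AddCommGroup X] [Module ℝ X] [AddCommGroup Y]
    [Module ℝ Y] {G : X → X → ℝ} (hG : IsInnerProduct G) (f : Y →ₗ[ℝ] X)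
    (hf : Function.Injective f) : IsInnerProduct fun v w => G (f v) (f w) := by
  obtain ⟨⟨B, hB⟩, hs, hp⟩ := hG
  exact ⟨⟨B.compl₁₂ f f, fun v w => hB _ _⟩, fun v w => hs _ _,
    fun v hv => hp _ ((map_ne_zero_iff f hf).2 hv)⟩

/-- The form is pulled back from `G` along the injective horizontal lift. Since every metric is some
`αᵀα`, this covers all of `Met(M)`. -/
theorem isInnerProduct_quarter_ebin {α : OneForm I M n} (hα : α ∈ fullRankForms I M n) :
    IsInnerProduct fun h k => (1 / 4 : ℝ) * ebin (pullbackMetric α) h k := by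
  simp only [quarter_ebin_eq hα]
  exact (isInnerProduct_generalizedEbin hα).comp (horizontalLift hα).toLinearMap
    (Function.LeftInverse.injective (pullbackDeriv_horizontalLift hα))

theorem horizontalLift_mem {α : OneForm I M n} (hα : α ∈ fullRankForms I M n)
    (k : SymTensor I M) :
    horizontalLift hα k ∈ horizontalSpace (generalizedEbin α) (pullbackDeriv α) := by
  intro w hw
  rw [generalizedEbin_eq hα, ← riemannianIntegral_zero (pullbackMetric α)]
  congr 1
  funext x
  have h : tensorVal ((pullbackDeriv α w).1 x) = 0 := by
    rw [hw]
    rfl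
  exact ebinIntegrand_liftBil_vertical (injective_formVal hα x) (k := tensorVal (k.1 x))
    (k.2 x) h

/-- The difference `v - lift (D v)` is vertical, and also horizontal as a difference of horizontal
vectors. It is thus orthogonal to itself and vanishes. -/
theorem horizontalLift_pullbackDeriv {α : OneForm I M n} (hα : α ∈ fullRankForms I M n)
    {v : OneForm I M n} (hv : v ∈ horizontalSpace (generalizedEbin α) (pullbackDeriv α)) :
    horizontalLift hα (pullbackDeriv α v) = v := by
  have hk := pullbackDeriv_sub_horizontalLift hα v
  obtain ⟨⟨B, hB⟩, -, hp⟩ := isInnerProduct_generalizedEbin hα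
  by_contra h0
  refine (hp (v - horizontalLift hα (pullbackDeriv α v))
    fun h => h0 (sub_eq_zero.1 h).symm).ne' ?_
  have h1 := DFunLike.congr_fun (B.map_sub v (horizontalLift hα (pullbackDeriv α v)))
    (v - horizontalLift hα (pullbackDeriv α v))
  rw [LinearMap.sub_apply, hB, hB, hB] at h1
  rw [h1, hv _ hk, horizontalLift_mem hα _ _ hk, sub_zero]

theorem isRiemannianSubmersion_pullbackMetric {m n : ℕ} {H : Type*} [TopologicalSpace H]
    (I : ModelWithCorners ℝ (EuclideanSpace ℝ (Fin m)) H)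
    (M : Type*) [TopologicalSpace M] [ChartedSpace H M] [IsManifold I ∞ M]
    [T2Space M] [CompactSpace M]
    (hne : (fullRankForms I M n).Nonempty) :
    IsRiemannianSubmersion (fullRankForms I M n) (riemannianMetrics I M)
      generalizedEbin (fun g h k => (1 / 4 : ℝ) * ebin g h k) pullbackMetric where
  isOpen_source := isOpen_fullRankForms
  isOpen_target := isOpen_riemannianMetrics
  inner_source _ hα := isInnerProduct_generalizedEbin hα
  inner_target g hg := by
    obtain ⟨α, hα, rfl⟩ := surjOn_pullbackMetric hne hg
    exact isInnerProduct_quarter_ebin hα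
  mapsTo := mapsTo_pullbackMetric
  surjOn := surjOn_pullbackMetric hne
  smooth := isFrechetSmooth_pullbackMetric _
  differential α hα := by
    refine ⟨pullbackDeriv α, hasGateauxDerivAt_pullbackMetric α,
      ⟨horizontalLift hα, pullbackDeriv_horizontalLift hα⟩, ⟨mapsTo_univ _ _, ?_, ?_⟩, ?_, ?_⟩
    · intro v hv w hw h
      rw [← horizontalLift_pullbackDeriv hα hv, h, horizontalLift_pullbackDeriv hα hw]
    · intro k _
      exact ⟨_, horizontalLift_mem hα k, pullbackDeriv_horizontalLift hα k⟩
    · intro v hv w hw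
      rw [quarter_ebin_eq hα, horizontalLift_pullbackDeriv hα hv,
        horizontalLift_pullbackDeriv hα hw]
    · intro u
      exact ⟨horizontalLift hα (pullbackDeriv α u), horizontalLift_mem hα _,
        u - horizontalLift hα (pullbackDeriv α u), pullbackDeriv_sub_horizontalLift hα u,
        (add_sub_cancel (G := OneForm I M n) _ _).symm⟩

end Main

end

theorem mainTheorem4 {m n : ℕ} {H : Type*} [TopologicalSpace H]
    (I : ModelWithCorners ℝ (EuclideanSpace ℝ (Fin m)) H)
    (M : Type*) [TopologicalSpace M] [ChartedSpace H M] [IsManifold I ∞ M]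
    [T2Space M] [CompactSpace M]
    (hne : (fullRankForms I M n).Nonempty) :
    IsRiemannianSubmersion (fullRankForms I M n) (riemannianMetrics I M)
      generalizedEbin (fun g h k => (1 / 4 : ℝ) * ebin g h k) pullbackMetric :=
  isRiemannianSubmersion_pullbackMetric I M hne
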